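/- Let $X\subset\mathbb R^n$ be a finite set of points with real weights $w_x$ (unweighted points are the case $w\equiv 0$). A sphere $S$ has a center $z\in\mathbb R^n$ and a squared radius $\sigma\in\mathbb R$ (possibly negative). It includes $x$ if $\|z-x\|^2\le \sigma+w_x$, excludes $x$ if $\|z-x\|^2\ge \sigma+w_x$, and $x$ lies on $S$ if both hold. "Smallest" means of smallest squared radius. Assume that $X$ is in general position: every $Q\subseteq X$ with at most $n+1$ points is affinely independent, and no point of $X\setminus Q$ lies on the smallest sphere through all points of $Q$ (a condition only on nonempty $Q$). Simplices are nonempty subsets of $X$. For $s\in\mathbb R$ (the squared radius; $s=r^2$ for radius $r\ge 0$) put $B_s(x)=\{y:\|y-x\|^2\le s+w_x\}$ and $\mathrm{vor}(x)=\{y:\|y-x\|^2-w_x\le\|y-p\|^2-w_p\ \forall p\in X\}$. Define - $\check{\mathrm C}\mathrm{ech}_s(X)$: the simplices $Q$ with $\bigcap_{x\in Q}B_s(x)\ne\emptyset$; - $\mathrm{Del}(X)$: those with $\bigcap_{x\in Q}\mathrm{vor}(x)\neq\emptyset$; - $\mathrm{Del}_s(X)$: those with $\bigcap_{x\in Q}(B_s(x)\cap\mathrm{vor}(x))\ne\emptyset$;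 - $\mathrm{Del\check Cech}_s(X)=\mathrm{Del}(X)\cap\check{\mathrm C}\mathrm{ech}_s(X)$. For $Q\in\mathrm{Del}(X)$, its Delaunay sphere is the smallest sphere that includes all points of $Q$ and excludes all points of $X$. For a Delaunay sphere $S$ with center $z$, let $\mathrm{On}\,S$ be the set of points of $X$ on $S$ and $\mathrm{Front}\,S$ the set of those points with positive coefficient when $z$ is written as an affine combination of $\mathrm{On}\,S$. Let $V_X$ be the set of intervals $[\mathrm{Front}\,S,\mathrm{On}\,S]=\{P:\mathrm{Front}\,S\subseteq P\subseteq\mathrm{On}\,S\}$ over all Delaunay spheres $S$ of simplices of $\mathrm{Del}(X)$, made into a directed graph with an arc $\mu\to\nu$ if $P\subseteq Q$ for some $P\in\mu$, $Q\in\nu$. $\mathrm{Wrap}_s(X)$ is the union of all intervals from which some one-element interval $\{Q\}\in V_X$, whose $Q$ has a Delaunay sphere of squared radius at most $s$, can be reached along a directed path. A discrete gradient on a complex $K$ is a partition $V$ of its simplices into singletons and pairs (simplex, facet) for which there is $f:K\to\mathbb R$ such that $P\subseteq Q$ implies $f(P)\le f(Q)$, with equality iff $P,Q$ lie in a common part of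 $V$. An elementary collapse removes a simplex $P$ and the only simplex $Q$ that properly contains it, where $\dim Q=\dim P+1$; $K\searrow L$ means that a finite sequence of elementary collapses leads from $K$ to $L$. **Theorem.** There is a discrete gradient $V$ on the full simplex of all nonempty subsets of $X$ such that for every $s\in\mathbb R$ the set $\mathrm{Wrap}_s(X)$ is a simplicial complex, $$\check{\mathrm C}\mathrm{ech}_s(X)\searrow\mathrm{Del\check Cech}_s(X)\searrow\mathrm{Del}_s(X)\searrow\mathrm{Wrap}_s(X),$$ and each of these three collapses $K\searrow L$ is induced by $V$: $L\subseteq K$, the parts of $V$ contained in $K$ form a discrete gradient on $K$, and $K\setminus L$ is a union of pairs of $V$. Consequently the four complexes are simple-homotopy equivalent, that is, related by finite sequences of elementary collapses and their inverses. -/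

import Mathlib

namespace CollapsingHierarchy

section Combinatorics

variable {α : Type*}

/-- An elementary collapse removes a simplex `P` together with a simplex `Q` of one dimension more,
where `Q` is the only simplex of `K` that properly contains `P` (so that `P` is a free face). -/
def ElementaryCollapse (K L : PreAbstractSimplicialComplex α) : Prop :=
  ∃ P Q : Finset α, P ∈ K.faces ∧ Q ∈ K.faces ∧ P ⋖ Q ∧ (∀ R ∈ K.faces, P ⊂ R → R = Q) ∧
    L.faces = K.faces \ {P, Q}

/-- `K` collapses onto `L`: a finite sequence of elementary collapses leads from `K` to `L`. -/
def Collapses (K L : PreAbstractSimplicialComplex α) : Prop :=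
  Relation.ReflTransGen ElementaryCollapse K L

/-- Simple-homotopy equivalence: a finite sequence of elementary collapses and their inverses
leads from `K` to `L`. -/
def SimpleHomotopyEquivalent (K L : PreAbstractSimplicialComplex α) : Prop :=
  Relation.EqvGen ElementaryCollapse K L

/-- A pair of simplices that is an arc of the Hasse diagram: a simplex and one of its facets. -/
def IsFacetPair (A : Set (Finset α)) : Prop :=
  ∃ P Q : Finset α, P ⋖ Q ∧ A = {P, Q}

/-- A discrete vector field on `K`: a partition of the set of simplices of `K` into singletons and
pairs that are arcs of the Hasse diagram. -/
def IsDiscreteVectorField (K : PreAbstractSimplicialComplex α) (V : Set (Set (Finset α))) : Prop :=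
  (∀ A ∈ V, (∃ Q : Finset α, A = {Q}) ∨ IsFacetPair A) ∧ V.PairwiseDisjoint id ∧ ⋃₀ V = K.faces

/-- `f` is a discrete Morse function on `K` whose discrete gradient is `V`: it is monotone with
respect to the face relation, with equality exactly inside a common part of `V`. -/
def IsDiscreteMorseFunction (K : PreAbstractSimplicialComplex α) (V : Set (Set (Finset α)))
    (f : Finset α → ℝ) : Prop :=
  ∀ P ∈ K.faces, ∀ Q ∈ K.faces, P ⊆ Q → f P ≤ f Q ∧ (f P = f Q ↔ ∃ A ∈ V, P ∈ A ∧ Q ∈ A)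

/-- A discrete gradient on `K`: a discrete vector field that belongs to a discrete Morse
function. -/
def IsDiscreteGradient (K : PreAbstractSimplicialComplex α) (V : Set (Set (Finset α))) : Prop :=
  IsDiscreteVectorField K V ∧ ∃ f : Finset α → ℝ, IsDiscreteMorseFunction K V f

/-- `V` (possibly living on a larger complex) induces a collapse from `K` onto its subcomplex `L`:
the parts of `V` inside `K` form a discrete gradient on `K`, and `K ∖ L` is a union of pairs
of `V`. -/
def InducesCollapse (V : Set (Set (Finset α))) (K L : PreAbstractSimplicialComplex α) : Prop :=
  IsDiscreteGradient K {A ∈ V | A ⊆ K.faces} ∧ L ≤ K ∧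
    ∃ C ⊆ V, (∀ A ∈ C, IsFacetPair A) ∧ K.faces \ L.faces = ⋃₀ C

/-- The nerve of the sets `U x`, `x ∈ X`: the nonempty `Q ⊆ X` for which the sets `U x`, `x ∈ Q`,
have a common point. -/
def nerve {β : Type*} (X : Finset α) (U : α → Set β) : PreAbstractSimplicialComplex α where
  faces := {Q | Q.Nonempty ∧ Q ⊆ X ∧ (⋂ x ∈ Q, U x).Nonempty}
  isRelLowerSet_faces := by
    rintro Q ⟨hQ, hQX, y, hy⟩
    refine ⟨hQ, fun P hPQ hP => ⟨hP, hPQ.trans hQX, y, ?_⟩⟩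
    simp only [Set.mem_iInter] at hy ⊢
    exact fun x hx => hy x (hPQ hx)

/-- The full simplex on `X`: all nonempty subsets of `X`. -/
def fullSimplex (X : Finset α) : PreAbstractSimplicialComplex α where
  faces := {Q | Q.Nonempty ∧ Q ⊆ X}
  isRelLowerSet_faces := fun _ hQ => ⟨hQ.1, fun _ hPQ hP => ⟨hP, hPQ.trans hQ.2⟩⟩

end Combinatorics

section Geometry

variable {n : ℕ}

/-- A sphere, given by its center and its squared radius, which is any real number and may be
negative. -/
structure WeightedSphere (n : ℕ) where
  center : EuclideanSpace ℝ (Fin n)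
  sqRadius : ℝ

/-- The sphere `S` includes the point `x` of weight `w x`. -/
def WeightedSphere.Includes (S : WeightedSphere n) (w : EuclideanSpace ℝ (Fin n) → ℝ)
    (x : EuclideanSpace ℝ (Fin n)) : Prop :=
  dist S.center x ^ 2 ≤ S.sqRadius + w x

/-- The sphere `S` excludes the point `x` of weight `w x`. -/
def WeightedSphere.Excludes (S : WeightedSphere n) (w : EuclideanSpace ℝ (Fin n) → ℝ)
    (x : EuclideanSpace ℝ (Fin n)) : Prop :=
  S.sqRadius + w x ≤ dist S.center x ^ 2

/-- The point `x` of weight `w x` lies on the sphere `S`. -/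
def WeightedSphere.Through (S : WeightedSphere n) (w : EuclideanSpace ℝ (Fin n) → ℝ)
    (x : EuclideanSpace ℝ (Fin n)) : Prop :=
  S.Includes w x ∧ S.Excludes w x

/-- `S` is a smallest sphere such that all points of `Q` lie on it. (There is none for `Q = ∅`,
because squared radii are unbounded below.) -/
def IsSmallestCircumsphere (w : EuclideanSpace ℝ (Fin n) → ℝ)
    (Q : Finset (EuclideanSpace ℝ (Fin n))) (S : WeightedSphere n) : Prop :=
  (∀ q ∈ Q, S.Through w q) ∧
    ∀ T : WeightedSphere n, (∀ q ∈ Q, T.Through w q) → S.sqRadius ≤ T.sqRadius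

/-- General position of the finite set `X` of points with weights `w`. -/
def InGeneralPosition (X : Finset (EuclideanSpace ℝ (Fin n)))
    (w : EuclideanSpace ℝ (Fin n) → ℝ) : Prop :=
  ∀ Q ⊆ X, Q.card ≤ n + 1 →
    AffineIndependent ℝ (fun q : Q => (q : EuclideanSpace ℝ (Fin n))) ∧
    ∀ S : WeightedSphere n, IsSmallestCircumsphere w Q S → ∀ x ∈ X, x ∉ Q → ¬ S.Through w x

/-- The ball of squared radius `s` around the point `x` of weight `w x`; for `w x = 0` and
`s = r ^ 2` with `0 ≤ r` this is the closed ball of radius `r`. -/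
def weightedBall (w : EuclideanSpace ℝ (Fin n) → ℝ) (s : ℝ) (x : EuclideanSpace ℝ (Fin n)) :
    Set (EuclideanSpace ℝ (Fin n)) :=
  {y | dist y x ^ 2 ≤ s + w x}

/-- The (weighted) Voronoi domain of `x` with respect to `X`. -/
def voronoiDomain (X : Finset (EuclideanSpace ℝ (Fin n))) (w : EuclideanSpace ℝ (Fin n) → ℝ)
    (x : EuclideanSpace ℝ (Fin n)) : Set (EuclideanSpace ℝ (Fin n)) :=
  {y | ∀ p ∈ X, dist y x ^ 2 - w x ≤ dist y p ^ 2 - w p}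

/-- The Čech complex for squared radius `s`. -/
def cech (X : Finset (EuclideanSpace ℝ (Fin n))) (w : EuclideanSpace ℝ (Fin n) → ℝ) (s : ℝ) :
    PreAbstractSimplicialComplex (EuclideanSpace ℝ (Fin n)) :=
  nerve X (weightedBall w s)

/-- The Delaunay complex (alpha complex) for squared radius `s`. -/
def delaunay (X : Finset (EuclideanSpace ℝ (Fin n))) (w : EuclideanSpace ℝ (Fin n) → ℝ) (s : ℝ) :
    PreAbstractSimplicialComplex (EuclideanSpace ℝ (Fin n)) :=
  nerve X (fun x => weightedBall w s x ∩ voronoiDomain X w x)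

/-- The Delaunay triangulation (Delaunay complex for infinite radius). -/
def delaunayTriangulation (X : Finset (EuclideanSpace ℝ (Fin n)))
    (w : EuclideanSpace ℝ (Fin n) → ℝ) : PreAbstractSimplicialComplex (EuclideanSpace ℝ (Fin n)) :=
  nerve X (voronoiDomain X w)

/-- The Delaunay–Čech complex for squared radius `s`: the restriction of the Čech complex to the
Delaunay triangulation. -/
def delaunayCech (X : Finset (EuclideanSpace ℝ (Fin n))) (w : EuclideanSpace ℝ (Fin n) → ℝ)
    (s : ℝ) : PreAbstractSimplicialComplex (EuclideanSpace ℝ (Fin n)) :=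
  delaunayTriangulation X w ⊓ cech X w s

/-- `S` is the Delaunay sphere of `Q`: the smallest sphere that includes all points of `Q` and
excludes all points of `X`. Its squared radius is the value at `Q` of the Delaunay radius
function. -/
def IsDelaunaySphere (X : Finset (EuclideanSpace ℝ (Fin n))) (w : EuclideanSpace ℝ (Fin n) → ℝ)
    (Q : Finset (EuclideanSpace ℝ (Fin n))) (S : WeightedSphere n) : Prop :=
  ((∀ q ∈ Q, S.Includes w q) ∧ ∀ x ∈ X, S.Excludes w x) ∧
    ∀ T : WeightedSphere n, (∀ q ∈ Q, T.Includes w q) → (∀ x ∈ X, T.Excludes w x) →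
      S.sqRadius ≤ T.sqRadius

open Classical in
/-- The set of points of `X` that lie on `S`. -/
noncomputable def onFace (X : Finset (EuclideanSpace ℝ (Fin n)))
    (w : EuclideanSpace ℝ (Fin n) → ℝ) (S : WeightedSphere n) :
    Finset (EuclideanSpace ℝ (Fin n)) :=
  {x ∈ X | S.Through w x}

open Classical in
/-- The front face of `S`: the points with a positive coefficient when the center of `S` is written
as an affine combination of the points of `X` on `S`. (In general position the coefficients are
unique.) -/
noncomputable def frontFace (X : Finset (EuclideanSpace ℝ (Fin n)))
    (w : EuclideanSpace ℝ (Fin n) → ℝ) (S : WeightedSphere n) :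
    Finset (EuclideanSpace ℝ (Fin n)) :=
  {x ∈ onFace X w S | ∃ ρ : EuclideanSpace ℝ (Fin n) → ℝ,
    ∑ y ∈ onFace X w S, ρ y = 1 ∧ ∑ y ∈ onFace X w S, ρ y • y = S.center ∧ 0 < ρ x}

/-- The generalized discrete gradient of the Delaunay radius function: the intervals between the
front face of `S` and the set of all points on `S`, over all Delaunay spheres `S` of simplices of
the Delaunay triangulation. -/
def delaunayGradient (X : Finset (EuclideanSpace ℝ (Fin n)))
    (w : EuclideanSpace ℝ (Fin n) → ℝ) : Set (Set (Finset (EuclideanSpace ℝ (Fin n)))) :=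
  {I | ∃ Q ∈ (delaunayTriangulation X w).faces, ∃ S : WeightedSphere n,
    IsDelaunaySphere X w Q S ∧ I = Set.Icc (frontFace X w S) (onFace X w S)}

/-- The arcs of the directed graph whose nodes are the intervals of the Delaunay gradient. -/
def GradientArc (X : Finset (EuclideanSpace ℝ (Fin n))) (w : EuclideanSpace ℝ (Fin n) → ℝ)
    (μ ν : Set (Finset (EuclideanSpace ℝ (Fin n)))) : Prop :=
  μ ∈ delaunayGradient X w ∧ ν ∈ delaunayGradient X w ∧ ∃ P ∈ μ, ∃ Q ∈ ν, P ⊆ Q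

/-- The lower set of a set `A` of intervals: the intervals of the Delaunay gradient from which `A`
can be reached along a directed path. -/
def lowerSet (X : Finset (EuclideanSpace ℝ (Fin n))) (w : EuclideanSpace ℝ (Fin n) → ℝ)
    (A : Set (Set (Finset (EuclideanSpace ℝ (Fin n))))) :
    Set (Set (Finset (EuclideanSpace ℝ (Fin n)))) :=
  {μ ∈ delaunayGradient X w | ∃ ν ∈ A, Relation.ReflTransGen (GradientArc X w) μ ν}

/-- The singular intervals `[Q, Q]` of the Delaunay gradient whose Delaunay sphere has squared
radius at most `s`. -/
def singularIntervals (X : Finset (EuclideanSpace ℝ (Fin n)))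
    (w : EuclideanSpace ℝ (Fin n) → ℝ) (s : ℝ) :
    Set (Set (Finset (EuclideanSpace ℝ (Fin n)))) :=
  {I ∈ delaunayGradient X w | ∃ (Q : Finset (EuclideanSpace ℝ (Fin n))) (S : WeightedSphere n),
    I = {Q} ∧ IsDelaunaySphere X w Q S ∧ S.sqRadius ≤ s}

/-- The simplices of the Wrap complex for squared radius `s`. -/
def wrapSimplices (X : Finset (EuclideanSpace ℝ (Fin n))) (w : EuclideanSpace ℝ (Fin n) → ℝ)
    (s : ℝ) : Set (Finset (EuclideanSpace ℝ (Fin n))) :=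
  ⋃₀ lowerSet X w (singularIntervals X w s)

end Geometry

end CollapsingHierarchy

open CollapsingHierarchy

namespace CollapsingHierarchy

/-! ### Collapses along a discrete gradient. -/

section Combinatorics

variable {α : Type*}

/-! Each nonempty `Q ⊆ X` is assigned two spheres. `C Q` is the smallest sphere that includes `Q`.
`D Q` minimizes the squared radius plus `M` times the total violation of the demand to exclude `X`,
subject to including `Q`. Unlike the Delaunay sphere, `D Q` exists for every `Q`; for `M` large it
is the Delaunay sphere whenever there is one (`exists_penalty`), and otherwise it fails to exclude
`X`. Hence membership of `Q` in each of the four complexes depends only on the pair `(C Q, D Q)`,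
and it suffices to find one gradient on the full simplex whose parts lie in level sets of this pair
and whose critical simplices are never removed.

Both spheres are characterized by Karush–Kuhn–Tucker conditions: the center is an affine combination
of `X`, where only points of `Q` may have positive coefficients, points strictly outside have
coefficient `0`, and points strictly inside have coefficient `-M` (with `M = 0` for `C Q`). General
position makes the coefficients unique. If `x` is strictly inside `C Q` and has a negative
coefficient for `D Q`, then adding `x` to `Q` or removing it preserves both sets of conditions and
so both spheres (`IsSphereSystem.flip`). Whether `x` has this property depends only on the two
spheres, so one such `x` can be chosen per level set and used to pair all of its simplices.

If there is no such `x`, weighting the powers with respect to `C Q` by the coefficients of `D Q`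
gives a nonpositive sum, so the radius of `D Q` is at most that of `C Q`. Uniqueness gives `C Q = D
Q`; this sphere excludes `X`, and `Q` is both its front face and its set of points on the sphere
(`IsSphereSystem.critical`). The level set is then the single simplex `Q`, whose Delaunay interval
is singular, and no collapse removes it: the conditions on `C` and `D` agree for it. -/

theorem Collapses.of_gradient {K L : PreAbstractSimplicialComplex α} (hK : K.faces.Finite)
    (hLK : L ≤ K) {V C : Set (Set (Finset α))} {f : Finset α → ℝ}
    (hV : V.PairwiseDisjoint id) (hf : IsDiscreteMorseFunction K V f) (hCV : C ⊆ V)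
    (hC : ∀ A ∈ C, IsFacetPair A) (hKL : K.faces \ L.faces = ⋃₀ C) : Collapses K L := by
  classical
  have hsub : ∀ m : ℕ, ∀ (K : PreAbstractSimplicialComplex α) (C : Set (Set (Finset α))),
      K.faces.Finite → L ≤ K → IsDiscreteMorseFunction K V f → C ⊆ V →
      (∀ A ∈ C, IsFacetPair A) → K.faces \ L.faces = ⋃₀ C →
      (K.faces \ L.faces).ncard ≤ m → Collapses K L := by
    intro m
    induction m with
    | zero =>
      intro K C hK hLK _ _ _ _ hm
      have h0 : K.faces \ L.faces = ∅ :=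
        (Set.ncard_eq_zero (hK.subset Set.sdiff_subset)).1 (Nat.le_zero.1 hm)
      have : K = L := le_antisymm (Set.sdiff_eq_empty.1 h0) hLK
      rw [this]
      exact Relation.ReflTransGen.refl
    | succ m ih =>
      intro K C hK hLK hf hCV hC hKL hm
      have hfin : (K.faces \ L.faces).Finite := hK.subset Set.sdiff_subset
      rcases (K.faces \ L.faces).eq_empty_or_nonempty with h0 | hne
      · have : K = L := le_antisymm (Set.sdiff_eq_empty.1 h0) hLK
        rw [this]
        exact Relation.ReflTransGen.refl
      -- The part of an `f`-maximal removed simplex can go first: a coface in `K` of its smaller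
      -- member `P` is not in `L`, as `L` is closed under faces, so by maximality it has the same
      -- value as `P` and lies in the same pair. Thus `P` is a free face.
      obtain ⟨T, hT, hmax⟩ := hfin.exists_maximalFor f _ hne
      have hmax : ∀ R ∈ K.faces \ L.faces, f R ≤ f T := fun R hR =>
        (le_total (f R) (f T)).elim id fun h => hmax hR h
      obtain ⟨A, hAC, hTA⟩ := Set.mem_sUnion.1 (hKL ▸ hT)
      obtain ⟨P, Q, hPQ, rfl⟩ := hC A hAC
      have hA : ∀ R ∈ ({P, Q} : Set (Finset α)), R ∈ K.faces \ L.faces := fun R hR => by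
        rw [hKL]; exact Set.mem_sUnion.2 ⟨_, hAC, hR⟩
      have hP := hA P (by simp)
      have hQ := hA Q (by simp)
      have hfPQ : f P = f Q := (hf P hP.1 Q hQ.1 hPQ.le).2.2 ⟨_, hCV hAC, by simp, by simp⟩
      have hfT : f T = f P := by
        rcases hTA with rfl | rfl
        · rfl
        · exact hfPQ.symm
      have hup : ∀ R ∈ K.faces, P ⊆ R → R = P ∨ R = Q := by
        intro R hR hPR
        have hRL : R ∉ L.faces := fun h =>
          hP.2 ((L.isRelLowerSet_faces h).2 hPR (K.isRelLowerSet_faces hP.1).1)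
        have h1 := hf P hP.1 R hR hPR
        obtain ⟨B, hB, hPB, hRB⟩ := h1.2.1 (le_antisymm h1.1 (hfT ▸ hmax R ⟨hR, hRL⟩))
        have : B = {P, Q} := by
          by_contra hne
          exact Set.disjoint_left.1 (hV hB (hCV hAC) hne) hPB (by simp)
        subst this
        exact hRB
      let K' : PreAbstractSimplicialComplex α :=
        { faces := K.faces \ {P, Q}
          isRelLowerSet_faces := by
            rintro R ⟨hR, hRPQ⟩
            refine ⟨(K.isRelLowerSet_faces hR).1, fun R' hR'R hR' =>
              ⟨(K.isRelLowerSet_faces hR).2 hR'R hR', ?_⟩⟩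
            rintro (rfl | rfl)
            · exact hRPQ (hup R hR hR'R)
            · exact hRPQ (hup R hR (hPQ.le.trans hR'R)) }
      have hdiff : K'.faces \ L.faces = (K.faces \ L.faces) \ {P, Q} := by
        ext R; simp only [K', Set.mem_sdiff]; tauto
      refine Relation.ReflTransGen.head (b := K')
        ⟨P, Q, hP.1, hQ.1, hPQ, fun R hR hPR => ((hup R hR hPR.1).resolve_left ?_), rfl⟩
        (ih K' (C \ {{P, Q}}) (hK.subset Set.sdiff_subset) ?_ ?_ ?_ ?_ ?_ ?_)
      · rintro rfl; exact hPR.2 subset_rfl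
      · intro R hR
        exact ⟨hLK hR, fun h => (hA R h).2 hR⟩
      · exact fun R hR R' hR' => hf R hR.1 R' hR'.1
      · exact Set.sdiff_subset.trans hCV
      · exact fun A hA => hC A hA.1
      · rw [hdiff, hKL]
        ext R
        constructor
        · rintro ⟨⟨B, hB, hRB⟩, hR⟩
          exact ⟨B, ⟨hB, fun h => hR (h ▸ hRB)⟩, hRB⟩
        · rintro ⟨B, ⟨hB, hne⟩, hRB⟩
          exact ⟨⟨B, hB, hRB⟩,
            fun hR => Set.disjoint_left.1 (hV (hCV hB) (hCV hAC) hne) hRB hR⟩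
      · have : (K'.faces \ L.faces).ncard < (K.faces \ L.faces).ncard := by
          rw [hdiff]
          refine Set.ncard_lt_ncard ⟨Set.sdiff_subset, fun h => (h hP).2 (by simp)⟩ hfin
        omega
  exact hsub _ K C hK hLK hf hCV hC hKL le_rfl

theorem IsDiscreteGradient.restrict {K₀ K : PreAbstractSimplicialComplex α}
    {V : Set (Set (Finset α))} (hV : IsDiscreteGradient K₀ V) (hK : K ≤ K₀)
    (hsat : ∀ A ∈ V, ∀ P ∈ A, P ∈ K.faces → A ⊆ K.faces) :
    IsDiscreteGradient K {A ∈ V | A ⊆ K.faces} := by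
  obtain ⟨⟨h1, h2, h3⟩, f, hf⟩ := hV
  refine ⟨⟨fun A hA => h1 A hA.1, h2.subset fun A hA => hA.1, ?_⟩, f, ?_⟩
  · refine Set.Subset.antisymm (Set.sUnion_subset fun A hA => hA.2) fun P hP => ?_
    have : P ∈ ⋃₀ V := h3 ▸ hK hP
    obtain ⟨A, hA, hPA⟩ := this
    exact ⟨A, ⟨hA, hsat A hA P hPA hP⟩, hPA⟩
  · intro P hP Q hQ hPQ
    obtain ⟨h4, h5⟩ := hf P (hK hP) Q (hK hQ) hPQ
    refine ⟨h4, h5.trans ⟨?_, ?_⟩⟩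
    · rintro ⟨A, hA, hPA, hQA⟩
      exact ⟨A, ⟨hA, hsat A hA P hPA hP⟩, hPA, hQA⟩
    · rintro ⟨A, hA, hPA, hQA⟩
      exact ⟨A, hA.1, hPA, hQA⟩

/-- Since `K` and `L` are unions of parts, so is `K \ L`; it contains no critical simplex, so all of
its parts are pairs. -/
theorem IsDiscreteGradient.collapses {K₀ K L : PreAbstractSimplicialComplex α}
    {V : Set (Set (Finset α))} (hV : IsDiscreteGradient K₀ V) (hfin : K₀.faces.Finite)
    (hK : K ≤ K₀) (hLK : L ≤ K)
    (hKsat : ∀ A ∈ V, ∀ P ∈ A, P ∈ K.faces → A ⊆ K.faces)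
    (hLsat : ∀ A ∈ V, ∀ P ∈ A, P ∈ L.faces → A ⊆ L.faces)
    (hcrit : ∀ Q ∈ K.faces, {Q} ∈ V → Q ∈ L.faces) :
    Collapses K L ∧ InducesCollapse V K L := by
  have hres := hV.restrict hK hKsat
  obtain ⟨⟨h1, h2, h3⟩, f, hf⟩ := hV
  have hpair : ∀ A ∈ {A ∈ V | A ⊆ K.faces \ L.faces}, IsFacetPair A := by
    rintro A ⟨hA, hAKL⟩
    rcases h1 A hA with ⟨Q, rfl⟩ | h
    · exact absurd (hcrit Q (hAKL rfl).1 hA) (hAKL rfl).2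
    · exact h
  have hunion : K.faces \ L.faces = ⋃₀ {A ∈ V | A ⊆ K.faces \ L.faces} := by
    refine Set.Subset.antisymm (fun P hP => ?_) (Set.sUnion_subset fun A hA => hA.2)
    have : P ∈ ⋃₀ V := h3 ▸ hK hP.1
    obtain ⟨A, hA, hPA⟩ := this
    exact ⟨A, ⟨hA, fun R hR => ⟨hKsat A hA P hPA hP.1 hR,
      fun hRL => hP.2 (hLsat A hA R hR hRL hPA)⟩⟩, hPA⟩
  refine ⟨Collapses.of_gradient (hfin.subset hK) hLK h2 (f := f) (fun P hP Q hQ => ?_)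
    (fun A hA => hA.1) hpair hunion, hres, hLK, _, fun A hA => hA.1, hpair, hunion⟩
  exact hf P (hK hP) Q (hK hQ)

theorem Collapses.simpleHomotopyEquivalent {K L : PreAbstractSimplicialComplex α}
    (h : Collapses K L) : SimpleHomotopyEquivalent K L := by
  induction h with
  | refl => exact Relation.EqvGen.refl _
  | tail _ h ih => exact ih.trans _ _ _ (Relation.EqvGen.rel _ _ h)

theorem fullSimplex_finite (X : Finset α) : (fullSimplex X).faces.Finite :=
  X.powerset.finite_toSet.subset fun Q hQ => by simpa using hQ.2

/-! ### Discrete gradients from vertex flips on level sets. -/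

/-- The part of `Q` when `Q` is paired by adding or removing the vertex `v`, if there is one. -/
def flipPart [DecidableEq α] (v : Option α) (Q : Finset α) : Set (Finset α) :=
  match v with
  | none => {Q}
  | some x => {Q.erase x, insert x (Q.erase x)}

theorem mem_flipPart_some [DecidableEq α] {x : α} {P Q : Finset α} :
    P ∈ flipPart (some x) Q ↔ P.erase x = Q.erase x := by
  constructor
  · rintro (rfl | rfl) <;> simp
  · intro h
    by_cases hx : x ∈ P
    · right
      rw [Set.mem_singleton_iff, ← h, Finset.insert_erase hx]
    · left
      rw [← h, Finset.erase_eq_of_notMem hx]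

/-- A monotone function `G ∘ k` whose level sets are, inside the relation of inclusion, those of
`k`, and each of which either is trivial or can be partitioned by flipping a common vertex, refines
to a discrete gradient. -/
theorem exists_gradient_of_flips [DecidableEq α] {β : Type*} (X : Finset α) (k : Finset α → β) (G : β → ℝ)
    (b : β → Option α)
    (hmono : ∀ P Q : Finset α, P.Nonempty → P ⊆ Q → Q ⊆ X →
      G (k P) ≤ G (k Q) ∧ (G (k P) = G (k Q) → k P = k Q))
    (hnone : ∀ P Q : Finset α, P.Nonempty → P ⊆ Q → Q ⊆ X → k P = k Q → b (k Q) = none → P = Q)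
    (hsome : ∀ Q : Finset α, Q.Nonempty → Q ⊆ X → ∀ x, b (k Q) = some x →
      x ∈ X ∧ (Q.erase x).Nonempty ∧ k (Q.erase x) = k Q ∧ k (insert x (Q.erase x)) = k Q) :
    ∃ V : Set (Set (Finset α)), IsDiscreteGradient (fullSimplex X) V ∧
      (∀ A ∈ V, ∀ P ∈ A, ∀ Q ∈ A, k P = k Q) ∧
      ∀ Q, {Q} ∈ V → Q.Nonempty ∧ Q ⊆ X ∧ b (k Q) = none := by
  have hself : ∀ v (Q : Finset α), Q ∈ flipPart v Q := by
    rintro (_ | x) Q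
    · rfl
    · rw [mem_flipPart_some]
  have hpart : ∀ Q ∈ (fullSimplex X).faces, ∀ P ∈ flipPart (b (k Q)) Q,
      P ∈ (fullSimplex X).faces ∧ k P = k Q := by
    rintro Q ⟨hQ, hQX⟩ P hP
    rcases hb : b (k Q) with _ | x
    · rw [hb] at hP
      obtain rfl : P = Q := hP
      exact ⟨⟨hQ, hQX⟩, rfl⟩
    · obtain ⟨hx, hne, h1, h2⟩ := hsome Q hQ hQX x hb
      rw [hb] at hP
      have hsub : Q.erase x ⊆ X := (Finset.erase_subset _ _).trans hQX
      rcases hP with rfl | rfl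
      · exact ⟨⟨hne, hsub⟩, h1⟩
      · exact ⟨⟨Finset.insert_nonempty _ _, Finset.insert_subset hx hsub⟩, h2⟩
  have heq : ∀ Q ∈ (fullSimplex X).faces, ∀ P ∈ flipPart (b (k Q)) Q,
      flipPart (b (k P)) P = flipPart (b (k Q)) Q := by
    intro Q hQ P hP
    rw [(hpart Q hQ P hP).2]
    rcases hb : b (k Q) with _ | x
    · rw [hb] at hP
      obtain rfl : P = Q := hP
      rfl
    · rw [hb, mem_flipPart_some] at hP
      simp only [flipPart, hP]
  -- The Morse function will be `G ∘ k` plus a correction between `0` and `ε * X.card`. There are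
  -- finitely many values of `G ∘ k`, so a small `ε` keeps the correction below every gap between
  -- them.
  obtain ⟨ε, hε, hgap⟩ : ∃ ε : ℝ, 0 < ε ∧ ∀ P ∈ X.powerset, ∀ Q ∈ X.powerset,
      G (k P) < G (k Q) → G (k P) + ε * X.card < G (k Q) := by
    have hlim : ∀ P Q : Finset α, G (k P) < G (k Q) →
        ∀ᶠ ε in nhdsWithin (0 : ℝ) (Set.Ioi 0), G (k P) + ε * X.card < G (k Q) := by
      intro P Q h
      have hc : Continuous fun ε : ℝ => G (k P) + ε * X.card := by fun_prop
      refine (hc.tendsto 0).mono_left nhdsWithin_le_nhds |>.eventually_lt_const ?_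
      simpa using h
    have : ∀ᶠ ε in nhdsWithin (0 : ℝ) (Set.Ioi 0), ∀ P ∈ X.powerset, ∀ Q ∈ X.powerset,
        G (k P) < G (k Q) → G (k P) + ε * X.card < G (k Q) := by
      rw [Filter.eventually_all_finset]
      intro P _
      rw [Filter.eventually_all_finset]
      intro Q _
      by_cases h : G (k P) < G (k Q)
      · simpa [h] using hlim P Q h
      · simp [h]
    obtain ⟨ε, h1, h2⟩ := (this.and self_mem_nhdsWithin).exists
    exact ⟨ε, h2, h1⟩
  -- Within a level set, the cardinality without the flipped vertex is constant on each pair and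
  -- strictly larger on a coface that belongs to a different pair.
  let r : Finset α → ℕ := fun Q => (b (k Q)).elim 0 fun x => (Q.erase x).card
  have hr : ∀ Q ⊆ X, r Q ≤ X.card := by
    intro Q hQ
    simp only [r]
    rcases b (k Q) with _ | x
    · simp
    · exact Finset.card_le_card ((Finset.erase_subset _ _).trans hQ)
  refine ⟨{A | ∃ Q ∈ (fullSimplex X).faces, A = flipPart (b (k Q)) Q}, ⟨⟨?_, ?_, ?_⟩,
    fun Q => G (k Q) + ε * r Q, ?_⟩, ?_, ?_⟩
  · rintro A ⟨Q, hQ, rfl⟩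
    rcases b (k Q) with _ | x
    · exact Or.inl ⟨Q, rfl⟩
    · exact Or.inr ⟨_, _, Finset.covBy_insert (Finset.notMem_erase x Q), rfl⟩
  · rintro A ⟨P, hP, rfl⟩ B ⟨Q, hQ, rfl⟩ hne
    refine Set.disjoint_left.2 fun R hRP hRQ => hne ?_
    rw [← heq P hP R hRP, heq Q hQ R hRQ]
  · ext Q
    constructor
    · rintro ⟨A, ⟨P, hP, rfl⟩, hQ⟩
      exact (hpart P hP Q hQ).1
    · intro hQ
      exact ⟨_, ⟨Q, hQ, rfl⟩, hself _ _⟩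
  · rintro P ⟨hP, hPX⟩ Q ⟨hQ, hQX⟩ hPQ
    obtain ⟨hle, hk⟩ := hmono P Q hP hPQ hQX
    have hexists : (∃ A ∈ {A | ∃ Q ∈ (fullSimplex X).faces, A = flipPart (b (k Q)) Q},
        P ∈ A ∧ Q ∈ A) ↔ P ∈ flipPart (b (k Q)) Q := by
      constructor
      · rintro ⟨A, ⟨R, hR, rfl⟩, hPA, hQA⟩
        rwa [heq R hR Q hQA]
      · exact fun h => ⟨_, ⟨Q, ⟨hQ, hQX⟩, rfl⟩, h, hself _ _⟩
    rw [hexists]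
    rcases hle.lt_or_eq with hlt | hEq
    · have h1 := hgap P (by simpa using hPX) Q (by simpa using hQX) hlt
      have h2 : ε * r P ≤ ε * X.card := by
        have : (r P : ℝ) ≤ X.card := by exact_mod_cast hr P hPX
        gcongr
      have h3 : 0 ≤ ε * r Q := by positivity
      refine ⟨by linarith, fun h => by linarith, fun h => ?_⟩
      rw [(hpart Q ⟨hQ, hQX⟩ P h).2] at hlt
      exact absurd hlt (lt_irrefl _)
    · have hkk := hk hEq
      rcases hb : b (k Q) with _ | x
      · obtain rfl := hnone P Q hP hPQ hQX hkk hb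
        simp [flipPart]
      · have hrP : r P = (P.erase x).card := by simp [r, hkk, hb]
        have hrQ : r Q = (Q.erase x).card := by simp [r, hb]
        have hsub : P.erase x ⊆ Q.erase x := Finset.erase_subset_erase _ hPQ
        beta_reduce
        rw [hkk, hrP, hrQ, mem_flipPart_some]
        have hcard : ((P.erase x).card : ℝ) ≤ (Q.erase x).card := by
          exact_mod_cast Finset.card_le_card hsub
        refine ⟨by gcongr, fun h => ?_, fun h => by rw [h]⟩
        refine Finset.eq_of_subset_of_card_le hsub ?_
        have := mul_left_cancel₀ hε.ne' (add_left_cancel h)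
        exact_mod_cast this.ge
  · rintro A ⟨R, hR, rfl⟩ P hP Q hQ
    rw [(hpart R hR P hP).2, (hpart R hR Q hQ).2]
  · rintro Q ⟨R, hR, h⟩
    have hQR : R ∈ ({Q} : Set (Finset α)) := h ▸ hself _ _
    obtain rfl : R = Q := hQR
    refine ⟨hR.1, hR.2, ?_⟩
    rcases hb : b (k R) with _ | x
    · rfl
    · rw [hb] at h
      have h1 : R.erase x ∈ ({R} : Set (Finset α)) := by rw [h]; left; rfl
      have h2 : insert x (R.erase x) ∈ ({R} : Set (Finset α)) := by rw [h]; right; rfl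
      have h3 : x ∈ R.erase x := by
        rw [Set.mem_singleton_iff.1 h1, ← Set.mem_singleton_iff.1 h2]
        exact Finset.mem_insert_self _ _
      exact absurd h3 (Finset.notMem_erase x R)

end Combinatorics

/-! ### Lagrange multipliers. -/

/-- Lagrange multipliers of a minimization problem with linearly independent active constraints
`ℓ x`, `x ∈ A`, each of which can be a hard or a soft constraint on either side. -/
theorem exists_multipliers {α V : Type*} [AddCommGroup V] [Module ℝ V] (A : Finset α)
    (ℓ : α → V →ₗ[ℝ] ℝ) (hℓ : LinearIndependent ℝ (fun x : A => ℓ x)) (Λ : V →ₗ[ℝ] ℝ) (M : ℝ)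
    (Q E : Finset α)
    (H : ∀ v, (∀ x ∈ A, x ∈ Q → ℓ x v ≤ 0) → (∀ x ∈ A, x ∈ E → 0 ≤ ℓ x v) →
      0 ≤ Λ v + M * ∑ x ∈ A, max 0 (-ℓ x v)) :
    ∃ ρ : α → ℝ, (∀ v, Λ v + ∑ x ∈ A, ρ x * ℓ x v = 0) ∧ (∀ x ∈ A, 0 < ρ x → x ∈ Q) ∧
      ∀ x ∈ A, ρ x < -M → x ∈ E := by
  classical
  have hspan : Λ ∈ Submodule.span ℝ (Set.range fun x : A => ℓ x) := by
    refine mem_span_of_iInf_ker_le_ker fun v hv => ?_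
    have hv : ∀ x ∈ A, ℓ x v = 0 := by
      intro x hx
      simpa using (Submodule.mem_iInf _).1 hv ⟨x, hx⟩
    -- Every direction in the common kernel is admissible together with its negative, so `Λ`
    -- vanishes there and lies in the span of the constraints.
    have hle : ∀ c : ℝ, 0 ≤ Λ (c • v) := by
      intro c
      have := H (c • v) (fun x hx _ => by simp [hv x hx]) (fun x hx _ => by simp [hv x hx])
      rwa [Finset.sum_eq_zero (fun x hx => by simp [hv x hx]), mul_zero, add_zero] at this
    have h1 := hle 1
    have h2 := hle (-1)
    simp only [map_smul, smul_eq_mul] at h1 h2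
    rw [LinearMap.mem_ker]
    linarith
  obtain ⟨c, hc⟩ := (Submodule.mem_span_range_iff_exists_fun ℝ).1 hspan
  have hΛ : ∀ v, Λ v = ∑ x ∈ A.attach, c x * ℓ x v := by
    intro v
    rw [← hc]
    simp [LinearMap.sum_apply]
  let ρ : α → ℝ := fun x => if h : x ∈ A then -c ⟨x, h⟩ else 0
  have hρ : ∀ v, Λ v = -∑ x ∈ A, ρ x * ℓ x v := by
    intro v
    rw [hΛ, ← Finset.sum_attach A, ← Finset.sum_neg_distrib]
    exact Finset.sum_congr rfl fun x _ => by simp [ρ, x.2]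
  -- A dual direction moves one constraint only. Testing `H` with `v` gives `ρ x ≤ 0` if `x ∉ Q`;
  -- testing with `-v` gives `-M ≤ ρ x` if `x ∉ E`, the term `M` being the cost of violating a soft
  -- constraint.
  have hdual : ∀ x ∈ A, ∃ v, ℓ x v = 1 ∧ ∀ y ∈ A, y ≠ x → ℓ y v = 0 := by
    intro x hx
    have hnot := hℓ.notMem_span_image (s := {y : A | y ≠ ⟨x, hx⟩}) (x := ⟨x, hx⟩) (by simp)
    have : ¬ (⨅ y : {y : A // y ≠ ⟨x, hx⟩}, LinearMap.ker (ℓ y)) ≤ LinearMap.ker (ℓ x) := by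
      intro hle
      refine hnot ?_
      have := mem_span_of_iInf_ker_le_ker hle
      rwa [Set.image_eq_range]
    obtain ⟨v, hv, hxv⟩ := SetLike.not_le_iff_exists.1 this
    rw [LinearMap.mem_ker] at hxv
    refine ⟨(ℓ x v)⁻¹ • v, by simp [hxv], fun y hy hyx => ?_⟩
    have : ℓ y v = 0 := by
      simpa using (Submodule.mem_iInf _).1 hv ⟨⟨y, hy⟩, by simpa using hyx⟩
    simp [this]
  refine ⟨ρ, fun v => by rw [hρ]; ring, fun x hx hpos => ?_, fun x hx hneg => ?_⟩
  · by_contra hxQ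
    obtain ⟨v, hv, hv'⟩ := hdual x hx
    have hnn : ∀ y ∈ A, 0 ≤ ℓ y v := by
      intro y hy
      by_cases h : y = x
      · rw [h, hv]; norm_num
      · rw [hv' y hy h]
    have := H v (fun y hy hyQ => (hv' y hy (by rintro rfl; exact hxQ hyQ)).le)
      (fun y hy _ => hnn y hy)
    rw [Finset.sum_eq_zero (fun y hy => max_eq_left (by linarith [hnn y hy])), hρ,
      Finset.sum_eq_single_of_mem x hx (fun y hy hyx => by rw [hv' y hy hyx, mul_zero]), hv] at this
    linarith
  · by_contra hxE
    obtain ⟨v, hv, hv'⟩ := hdual x hx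
    have hnn : ∀ y ∈ A, 0 ≤ ℓ y v := by
      intro y hy
      by_cases h : y = x
      · rw [h, hv]; norm_num
      · rw [hv' y hy h]
    have := H (-v) (fun y hy _ => by simpa using hnn y hy)
      (fun y hy hyE => by simp [hv' y hy (by rintro rfl; exact hxE hyE)])
    rw [Finset.sum_eq_single_of_mem x hx (fun y hy hyx => by simp [hv' y hy hyx]), hρ,
      Finset.sum_eq_single_of_mem x hx (fun y hy hyx => by simp [hv' y hy hyx])] at this
    simp [hv] at this
    linarith

/-! ### Powers of points and general position. -/

section Geometry

variable {n : ℕ} {X : Finset (EuclideanSpace ℝ (Fin n))} {w : EuclideanSpace ℝ (Fin n) → ℝ}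

/-- The power of the weighted point `x` with respect to the sphere `S`. -/
noncomputable def WeightedSphere.power (S : WeightedSphere n) (w : EuclideanSpace ℝ (Fin n) → ℝ)
    (x : EuclideanSpace ℝ (Fin n)) : ℝ :=
  dist S.center x ^ 2 - S.sqRadius - w x

theorem WeightedSphere.includes_iff {S : WeightedSphere n} {x : EuclideanSpace ℝ (Fin n)} :
    S.Includes w x ↔ S.power w x ≤ 0 := by
  unfold Includes power
  constructor <;> intro h <;> linarith

theorem WeightedSphere.excludes_iff {S : WeightedSphere n} {x : EuclideanSpace ℝ (Fin n)} :
    S.Excludes w x ↔ 0 ≤ S.power w x := by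
  unfold Excludes power
  constructor <;> intro h <;> linarith

theorem WeightedSphere.through_iff {S : WeightedSphere n} {x : EuclideanSpace ℝ (Fin n)} :
    S.Through w x ↔ S.power w x = 0 := by
  rw [Through, includes_iff, excludes_iff, le_antisymm_iff]

theorem mem_onFace {S : WeightedSphere n} {x : EuclideanSpace ℝ (Fin n)} :
    x ∈ onFace X w S ↔ x ∈ X ∧ S.power w x = 0 := by
  simp [onFace, WeightedSphere.through_iff]

/-- The squared radii of two spheres are compared through the powers of points that represent the
center of one of them as an affine combination. -/
theorem sqRadius_eq_add {A : Finset (EuclideanSpace ℝ (Fin n))} {S : WeightedSphere n}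
    {ρ : EuclideanSpace ℝ (Fin n) → ℝ} (h1 : ∑ x ∈ A, ρ x = 1)
    (h2 : ∑ x ∈ A, ρ x • x = S.center) (T : WeightedSphere n) :
    T.sqRadius = S.sqRadius + dist T.center S.center ^ 2 + ∑ x ∈ A, ρ x * S.power w x -
      ∑ x ∈ A, ρ x * T.power w x := by
  -- The powers with respect to `T` and `S` differ by a constant and a term linear in `S.center -
  -- x`; averaging with the weights `ρ` kills the linear term.
  have hsum : ∑ x ∈ A, ρ x • (S.center - x) = 0 := by
    simp only [smul_sub, Finset.sum_sub_distrib, ← Finset.sum_smul, h1, h2, one_smul, sub_self]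
  have hx : ∀ x, T.power w x = S.power w x + (dist T.center S.center ^ 2 + S.sqRadius -
      T.sqRadius) + 2 * inner ℝ (T.center - S.center) (S.center - x) := by
    intro x
    have : T.center - x = (T.center - S.center) + (S.center - x) := by abel
    simp only [WeightedSphere.power, dist_eq_norm]
    rw [this, norm_add_sq_real]
    ring
  have h3 : ∑ x ∈ A, ρ x * inner ℝ (T.center - S.center) (S.center - x) = 0 := by
    simp only [← real_inner_smul_right, ← inner_sum, hsum, inner_zero_right]
  have h4 : ∑ x ∈ A, ρ x * T.power w x = ∑ x ∈ A, ρ x * S.power w x +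
      (∑ x ∈ A, ρ x) * (dist T.center S.center ^ 2 + S.sqRadius - T.sqRadius) +
      2 * ∑ x ∈ A, ρ x * inner ℝ (T.center - S.center) (S.center - x) := by
    rw [Finset.sum_mul, Finset.mul_sum, ← Finset.sum_add_distrib, ← Finset.sum_add_distrib]
    refine Finset.sum_congr rfl fun x _ => ?_
    rw [hx]; ring
  rw [h3, h1] at h4
  linarith

/-- A sphere through `A` whose center lies in the affine hull of `A` is the smallest sphere through
`A`, by `sqRadius_eq_add`; general position then forbids further points on it. -/
theorem onFace_subset_of_center (hX : InGeneralPosition X w) {S : WeightedSphere n}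
    {A : Finset (EuclideanSpace ℝ (Fin n))} (hA : A ⊆ onFace X w S) (hcard : A.card ≤ n + 1)
    {ρ : EuclideanSpace ℝ (Fin n) → ℝ} (h1 : ∑ x ∈ A, ρ x = 1)
    (h2 : ∑ x ∈ A, ρ x • x = S.center) : onFace X w S ⊆ A := by
  intro x hx
  by_contra hxA
  have hAX : A ⊆ X := fun y hy => (mem_onFace.1 (hA hy)).1
  refine (hX A hAX hcard).2 S ⟨fun q hq => ?_, fun T hT => ?_⟩ x (mem_onFace.1 hx).1 hxA ?_
  · exact WeightedSphere.through_iff.2 (mem_onFace.1 (hA hq)).2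
  · rw [sqRadius_eq_add (w := w) h1 h2 T]
    rw [Finset.sum_eq_zero (fun y hy => by rw [(mem_onFace.1 (hA hy)).2, mul_zero]),
      Finset.sum_eq_zero (fun y hy => by rw [WeightedSphere.through_iff.1 (hT y hy), mul_zero])]
    nlinarith [sq_nonneg (dist T.center S.center)]
  · exact WeightedSphere.through_iff.2 (mem_onFace.1 hx).2

theorem card_onFace_le (hX : InGeneralPosition X w) (S : WeightedSphere n) :
    (onFace X w S).card ≤ n + 1 := by
  by_contra! hlt
  obtain ⟨A, hA, hcard⟩ := Finset.exists_subset_card_eq hlt.le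
  have hAX : A ⊆ X := fun y hy => (mem_onFace.1 (hA hy)).1
  have hind := (hX A hAX hcard.le).1
  have hmem : S.center ∈ affineSpan ℝ (Set.range fun q : A => (q : EuclideanSpace ℝ (Fin n))) := by
    -- Any `n + 1` of the points on `S` are affinely independent and span the whole space, so the
    -- center is in their hull and no further point can lie on `S`.
    rw [hind.affineSpan_eq_top_iff_card_eq_finrank_add_one.2 (by simp [hcard])]
    trivial
  obtain ⟨c, hc, hcomb⟩ := eq_affineCombination_of_mem_affineSpan_of_fintype hmem
  rw [Finset.affineCombination_eq_linear_combination _ _ _ hc] at hcomb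
  classical
  let ρ : EuclideanSpace ℝ (Fin n) → ℝ := fun x => if h : x ∈ A then c ⟨x, h⟩ else 0
  have h1 : ∑ x ∈ A, ρ x = 1 := by
    rw [← hc, ← Finset.sum_attach A]
    exact Finset.sum_congr rfl fun x _ => by simp [ρ, x.2]
  have h2 : ∑ x ∈ A, ρ x • x = S.center := by
    rw [hcomb, ← Finset.sum_attach A]
    exact Finset.sum_congr rfl fun x _ => by simp [ρ, x.2]
  have := Finset.card_le_card (onFace_subset_of_center hX hA hcard.le h1 h2)
  omega

theorem affineIndependent_onFace (hX : InGeneralPosition X w) (S : WeightedSphere n) :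
    AffineIndependent ℝ (fun q : onFace X w S => (q : EuclideanSpace ℝ (Fin n))) :=
  (hX _ (fun _ hy => (mem_onFace.1 hy).1) (card_onFace_le hX S)).1

theorem eq_zero_of_sum_onFace (hX : InGeneralPosition X w) {S : WeightedSphere n}
    {ρ : EuclideanSpace ℝ (Fin n) → ℝ} (h1 : ∑ x ∈ onFace X w S, ρ x = 0)
    (h2 : ∑ x ∈ onFace X w S, ρ x • x = 0) : ∀ x ∈ onFace X w S, ρ x = 0 := by
  intro x hx
  refine affineIndependent_iff.1 (affineIndependent_onFace hX S) Finset.univ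
    (fun y => ρ y) ?_ ?_ ⟨x, hx⟩ (Finset.mem_univ _)
  · exact (Finset.sum_coe_sort (onFace X w S) ρ).trans h1
  · exact (Finset.sum_coe_sort (onFace X w S) fun y => ρ y • y).trans h2

/-! ### Penalized spheres: optimality conditions and uniqueness. -/

/-- The squared radius of `S` plus `M` times the total violation of the condition that `S`
excludes the points of `X`. -/
noncomputable def penalizedSqRadius (X : Finset (EuclideanSpace ℝ (Fin n)))
    (w : EuclideanSpace ℝ (Fin n) → ℝ) (M : ℝ) (S : WeightedSphere n) : ℝ :=
  S.sqRadius + M * ∑ x ∈ X, max 0 (-S.power w x)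

/-- `S` includes the points of `Q` and excludes the points of `E`. -/
def IsFeasible (w : EuclideanSpace ℝ (Fin n) → ℝ) (E Q : Finset (EuclideanSpace ℝ (Fin n)))
    (S : WeightedSphere n) : Prop :=
  (∀ q ∈ Q, S.power w q ≤ 0) ∧ ∀ x ∈ E, 0 ≤ S.power w x

/-- `ρ` represents the center of `S` as an affine combination in which the coefficient of a point
strictly outside `S` is `0` and that of a point strictly inside `S` is `-M`. -/
structure IsStationary (X : Finset (EuclideanSpace ℝ (Fin n)))
    (w : EuclideanSpace ℝ (Fin n) → ℝ) (M : ℝ) (S : WeightedSphere n)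
    (ρ : EuclideanSpace ℝ (Fin n) → ℝ) : Prop where
  sum_eq : ∑ x ∈ X, ρ x = 1
  center_eq : ∑ x ∈ X, ρ x • x = S.center
  of_pos : ∀ x ∈ X, 0 < S.power w x → ρ x = 0
  of_neg : ∀ x ∈ X, S.power w x < 0 → ρ x = -M

/-- The Karush–Kuhn–Tucker conditions for `S` to have the smallest penalized squared radius among
the spheres that include `Q` and exclude `E`. -/
structure IsKKT (X : Finset (EuclideanSpace ℝ (Fin n)))
    (w : EuclideanSpace ℝ (Fin n) → ℝ) (M : ℝ) (E Q : Finset (EuclideanSpace ℝ (Fin n)))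
    (S : WeightedSphere n) (ρ : EuclideanSpace ℝ (Fin n) → ℝ) : Prop
    extends IsStationary X w M S ρ where
  feasible : IsFeasible w E Q S
  front : ∀ x ∈ X, 0 < ρ x → x ∈ Q
  back : ∀ x ∈ X, ρ x < -M → x ∈ E

theorem IsStationary.sum_onFace {M : ℝ} {S : WeightedSphere n} {ρ : EuclideanSpace ℝ (Fin n) → ℝ}
    (h : IsStationary X w M S ρ) (hS : ∀ x ∈ X, 0 ≤ S.power w x) :
    ∑ x ∈ onFace X w S, ρ x = 1 ∧ ∑ x ∈ onFace X w S, ρ x • x = S.center := by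
  have hsub : onFace X w S ⊆ X := fun x hx => (mem_onFace.1 hx).1
  have h0 : ∀ x ∈ X, x ∉ onFace X w S → ρ x = 0 := by
    intro x hx hxS
    exact h.of_pos x hx ((hS x hx).lt_of_ne fun h0 => hxS (mem_onFace.2 ⟨hx, h0.symm⟩))
  exact ⟨(Finset.sum_subset hsub h0).trans h.sum_eq,
    (Finset.sum_subset hsub fun x hx hxS => by rw [h0 x hx hxS, zero_smul]).trans h.center_eq⟩

/-- Off the sphere the coefficients are prescribed, and on it affine independence determines them.
Hence the sign of a coefficient depends only on the sphere, not on the simplex that produced it. -/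
theorem IsStationary.unique (hX : InGeneralPosition X w) {M : ℝ} {S : WeightedSphere n}
    {ρ ρ' : EuclideanSpace ℝ (Fin n) → ℝ} (h : IsStationary X w M S ρ)
    (h' : IsStationary X w M S ρ') : ∀ x ∈ X, ρ x = ρ' x := by
  have hsub : onFace X w S ⊆ X := fun x hx => (mem_onFace.1 hx).1
  have h0 : ∀ x ∈ X, x ∉ onFace X w S → ρ x - ρ' x = 0 := by
    intro x hx hxS
    rcases lt_trichotomy (S.power w x) 0 with hlt | heq | hgt
    · rw [h.of_neg x hx hlt, h'.of_neg x hx hlt, sub_self]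
    · exact absurd (mem_onFace.2 ⟨hx, heq⟩) hxS
    · rw [h.of_pos x hx hgt, h'.of_pos x hx hgt, sub_self]
  intro x hx
  rw [← sub_eq_zero]
  by_cases hxS : x ∈ onFace X w S
  · refine eq_zero_of_sum_onFace (ρ := fun x => ρ x - ρ' x) hX ?_ ?_ x hxS
    · rw [Finset.sum_subset hsub h0, Finset.sum_sub_distrib, h.sum_eq, h'.sum_eq, sub_self]
    · rw [Finset.sum_subset hsub fun x hx hxS => by rw [h0 x hx hxS, zero_smul]]
      simp only [sub_smul, Finset.sum_sub_distrib, h.center_eq, h'.center_eq, sub_self]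
  · exact h0 x hx hxS

theorem IsStationary.sum_mul_power {M : ℝ} {S : WeightedSphere n}
    {ρ : EuclideanSpace ℝ (Fin n) → ℝ} (h : IsStationary X w M S ρ) :
    ∑ x ∈ X, ρ x * S.power w x = M * ∑ x ∈ X, max 0 (-S.power w x) := by
  rw [Finset.mul_sum]
  refine Finset.sum_congr rfl fun x hx => ?_
  rcases lt_trichotomy (S.power w x) 0 with hlt | heq | hgt
  · rw [h.of_neg x hx hlt, max_eq_right (by linarith)]; ring
  · simp [heq]
  · rw [h.of_pos x hx hgt, max_eq_left (by linarith)]; ring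

/-- Weak duality: the sign conditions bound each `ρ x * T.power w x` by the penalty that `x`
contributes for `T`. The quadratic gap is what makes minimizers unique. -/
theorem IsKKT.add_le {M : ℝ} {E Q : Finset (EuclideanSpace ℝ (Fin n))} {S T : WeightedSphere n}
    {ρ : EuclideanSpace ℝ (Fin n) → ℝ} (hM : 0 ≤ M) (h : IsKKT X w M E Q S ρ)
    (hT : IsFeasible w E Q T) :
    penalizedSqRadius X w M S + dist T.center S.center ^ 2 ≤ penalizedSqRadius X w M T := by
  have key := sqRadius_eq_add (w := w) h.sum_eq h.center_eq T
  rw [h.sum_mul_power] at key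
  have : ∑ x ∈ X, ρ x * T.power w x ≤ M * ∑ x ∈ X, max 0 (-T.power w x) := by
    rw [Finset.mul_sum]
    refine Finset.sum_le_sum fun x hx => ?_
    have hr : 0 ≤ M * max 0 (-T.power w x) := mul_nonneg hM (le_max_left _ _)
    rcases lt_or_ge 0 (ρ x) with hpos | hnp
    · exact (mul_nonpos_of_nonneg_of_nonpos hpos.le (hT.1 x (h.front x hx hpos))).trans hr
    rcases le_or_gt 0 (T.power w x) with hT0 | hT0
    · exact (mul_nonpos_of_nonpos_of_nonneg hnp hT0).trans hr
    · have hρM : -M ≤ ρ x := by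
        by_contra! hlt
        linarith [hT.2 x (h.back x hx hlt)]
      rw [max_eq_right (by linarith)]
      nlinarith
  unfold penalizedSqRadius
  linarith

theorem IsKKT.eq_of_le {M : ℝ} {E Q : Finset (EuclideanSpace ℝ (Fin n))} {S T : WeightedSphere n}
    {ρ : EuclideanSpace ℝ (Fin n) → ℝ} (hM : 0 ≤ M) (h : IsKKT X w M E Q S ρ)
    (hT : IsFeasible w E Q T) (hle : penalizedSqRadius X w M T ≤ penalizedSqRadius X w M S) :
    T = S := by
  have key := h.add_le hM hT
  have hd : dist T.center S.center = 0 := by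
    have := sq_nonneg (dist T.center S.center)
    exact pow_eq_zero_iff two_ne_zero |>.1 (by linarith)
  have heq : penalizedSqRadius X w M T = penalizedSqRadius X w M S := by
    rw [hd] at key; linarith
  have hc := dist_eq_zero.1 hd
  -- With the centers equal, only the radii are left to compare: enlarging a sphere about a fixed
  -- center strictly raises the penalized value.
  have hmono : ∀ U U' : WeightedSphere n, U.center = U'.center → U.sqRadius < U'.sqRadius →
      penalizedSqRadius X w M U < penalizedSqRadius X w M U' := by
    intro U U' hUc hUr
    have : ∑ x ∈ X, max 0 (-U.power w x) ≤ ∑ x ∈ X, max 0 (-U'.power w x) := by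
      refine Finset.sum_le_sum fun x _ => max_le_max le_rfl ?_
      simp only [WeightedSphere.power, hUc]
      linarith
    have := mul_le_mul_of_nonneg_left this hM
    unfold penalizedSqRadius
    linarith
  have hr : T.sqRadius = S.sqRadius := by
    rcases lt_trichotomy T.sqRadius S.sqRadius with hlt | h | hgt
    · exact absurd heq (hmono T S hc hlt).ne
    · exact h
    · exact absurd heq (hmono S T hc.symm hgt).ne'
  cases T; cases S
  simp_all

/-! ### Existence of minimizers and of their multipliers. -/

open Classical in
theorem exists_isKKT_of_minimal (hX : InGeneralPosition X w) {M : ℝ} (hM : 0 ≤ M)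
    {E Q : Finset (EuclideanSpace ℝ (Fin n))} (hEX : E ⊆ X) (hQX : Q ⊆ X)
    {S : WeightedSphere n} (hS : IsFeasible w E Q S)
    (hmin : ∀ T, IsFeasible w E Q T → penalizedSqRadius X w M S ≤ penalizedSqRadius X w M T) :
    ∃ ρ, IsKKT X w M E Q S ρ := by
  let ℓ : EuclideanSpace ℝ (Fin n) → (EuclideanSpace ℝ (Fin n) × ℝ) →ₗ[ℝ] ℝ := fun x =>
    LinearMap.snd ℝ _ ℝ + (2 : ℝ) • ((innerₛₗ ℝ (S.center - x)) ∘ₗ LinearMap.fst ℝ _ ℝ)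
  have hℓ : ∀ x v, ℓ x v = v.2 + 2 * inner ℝ (S.center - x) v.1 := fun x v => by
    simp [ℓ, inner_sub_left]
  -- The quadratic term in the radius makes every power exactly affine in `t`, with slope `ℓ x v`.
  let St : (EuclideanSpace ℝ (Fin n) × ℝ) → ℝ → WeightedSphere n := fun v t =>
    ⟨S.center + t • v.1, S.sqRadius - t * v.2 + t ^ 2 * ‖v.1‖ ^ 2⟩
  have hpow : ∀ v t x, (St v t).power w x = S.power w x + t * ℓ x v := by
    intro v t x
    have : S.center + t • v.1 - x = (S.center - x) + t • v.1 := by abel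
    simp only [St, WeightedSphere.power, dist_eq_norm, hℓ]
    rw [this, norm_add_sq_real, norm_smul, real_inner_smul_right, mul_pow, Real.norm_eq_abs, sq_abs]
    ring
  let A := onFace X w S
  have hAX : A ⊆ X := fun x hx => (mem_onFace.1 hx).1
  have hlin : LinearIndependent ℝ (fun x : A => ℓ x) := by
    rw [Fintype.linearIndependent_iff]
    intro c hc x
    have hv : ∀ v, ∑ x : A, c x * ℓ x v = 0 := by
      intro v
      have := LinearMap.congr_fun hc v
      simpa [LinearMap.sum_apply] using this
    have h1 : ∑ x : A, c x = 0 := by simpa [hℓ] using hv (0, 1)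
    refine affineIndependent_iff.1 (affineIndependent_onFace hX S) Finset.univ c h1 ?_ x
      (Finset.mem_univ _)
    refine ext_inner_right ℝ fun d => ?_
    have h2 := hv (d, 0)
    simp only [hℓ, inner_sub_left, zero_add] at h2
    have h3 : ∑ x : A, c x * (2 * (inner ℝ S.center d - inner ℝ (x : EuclideanSpace ℝ (Fin n)) d))
        = (∑ x : A, c x) * (2 * inner ℝ S.center d) -
          2 * ∑ x : A, c x * inner ℝ (x : EuclideanSpace ℝ (Fin n)) d := by
      rw [Finset.sum_mul, Finset.mul_sum, ← Finset.sum_sub_distrib]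
      exact Finset.sum_congr rfl fun x _ => by ring
    rw [h3, h1] at h2
    simp only [sum_inner, real_inner_smul_left, inner_zero_left]
    linarith
  -- The linear part of the one-sided derivative of the penalized radius: the radius itself and the
  -- penalties of points strictly inside. Points on `S` contribute the nonlinear terms `max 0 (-ℓ x
  -- v)`.
  let Λ : (EuclideanSpace ℝ (Fin n) × ℝ) →ₗ[ℝ] ℝ :=
    -LinearMap.snd ℝ _ ℝ - M • ∑ x ∈ X with S.power w x < 0, ℓ x
  have hΛ : ∀ v, Λ v = -v.2 - M * ∑ x ∈ X with S.power w x < 0, ℓ x v := fun v => by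
    simp [Λ, LinearMap.sum_apply]
  obtain ⟨ρ, hρ, hρQ, hρE⟩ := exists_multipliers A ℓ hlin Λ M Q E (by
    intro v hvQ hvE
    let m : EuclideanSpace ℝ (Fin n) → ℝ := fun x =>
      if S.power w x < 0 then -ℓ x v else if x ∈ A then max 0 (-ℓ x v) else 0
    have hm : ∑ x ∈ X, m x =
        -∑ x ∈ X with S.power w x < 0, ℓ x v + ∑ x ∈ A, max 0 (-ℓ x v) := by
      rw [← Finset.sum_neg_distrib, Finset.sum_filter, ← Finset.inter_eq_right.2 hAX,
        ← Finset.sum_ite_mem, ← Finset.sum_add_distrib]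
      refine Finset.sum_congr rfl fun x hx => ?_
      by_cases h : S.power w x < 0
      · have : x ∉ A := fun h' => h.ne (mem_onFace.1 h').2
        simp [m, h, this]
      · simp [m, h]
    have hev : ∀ x, ∀ᶠ t in nhdsWithin (0 : ℝ) (Set.Ioi 0),
        (S.power w x < 0 → (St v t).power w x < 0) ∧
        (0 < S.power w x → 0 < (St v t).power w x) := by
      intro x
      have hc : Filter.Tendsto (fun t : ℝ => S.power w x + t * ℓ x v)
          (nhdsWithin (0 : ℝ) (Set.Ioi 0)) (nhds (S.power w x)) := by
        have : Continuous fun t : ℝ => S.power w x + t * ℓ x v := by fun_prop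
        simpa using (this.tendsto 0).mono_left nhdsWithin_le_nhds
      simp only [hpow]
      rw [Filter.eventually_and]
      constructor
      · by_cases h : S.power w x < 0
        · simpa [h] using hc.eventually_lt_const h
        · simp [h]
      · by_cases h : 0 < S.power w x
        · simpa [h] using hc.eventually_const_lt h
        · simp [h]
    have hevX : ∀ᶠ t in nhdsWithin (0 : ℝ) (Set.Ioi 0), ∀ x ∈ X,
        (S.power w x < 0 → (St v t).power w x < 0) ∧
        (0 < S.power w x → 0 < (St v t).power w x) :=
      (Filter.eventually_all_finset _).2 fun x _ => hev x
    have hdir : ∀ᶠ t in nhdsWithin (0 : ℝ) (Set.Ioi 0),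
        0 ≤ -v.2 + M * ∑ x ∈ X, m x + t * ‖v.1‖ ^ 2 := by
      filter_upwards [hevX, self_mem_nhdsWithin] with t ht ht0
      rw [Set.mem_Ioi] at ht0
      have hfeas : IsFeasible w E Q (St v t) := by
        constructor
        · intro q hq
          rcases (hS.1 q hq).lt_or_eq with h | h
          · exact ((ht q (hQX hq)).1 h).le
          · rw [hpow, h, zero_add]
            exact mul_nonpos_of_nonneg_of_nonpos ht0.le (hvQ q (mem_onFace.2 ⟨hQX hq, h⟩) hq)
        · intro x hx
          rcases (hS.2 x hx).lt_or_eq with h | h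
          · exact ((ht x (hEX hx)).2 h).le
          · rw [hpow, ← h, zero_add]
            exact mul_nonneg ht0.le (hvE x (mem_onFace.2 ⟨hEX hx, h.symm⟩) hx)
      have hsum : ∑ x ∈ X, max 0 (-(St v t).power w x) =
          ∑ x ∈ X, max 0 (-S.power w x) + t * ∑ x ∈ X, m x := by
        rw [Finset.mul_sum, ← Finset.sum_add_distrib]
        refine Finset.sum_congr rfl fun x hx => ?_
        rcases lt_trichotomy (S.power w x) 0 with h | h | h
        · have h' := (ht x hx).1 h
          rw [max_eq_right (by linarith), max_eq_right (by linarith), hpow]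
          simp only [m, h, if_true]
          ring
        · have hxA : x ∈ A := mem_onFace.2 ⟨hx, h⟩
          rw [hpow, h]
          simp only [m, h, lt_irrefl, if_false, hxA, if_true, neg_zero, max_self, zero_add]
          rw [mul_max_of_nonneg _ _ ht0.le, mul_zero, mul_neg]
        · have h' := (ht x hx).2 h
          have hxA : x ∉ A := fun h' => h.ne' (mem_onFace.1 h').2
          rw [max_eq_left (by linarith), max_eq_left (by linarith)]
          simp [m, h.not_gt, hxA]
      have := hmin _ hfeas
      simp only [penalizedSqRadius, hsum] at this
      refine nonneg_of_mul_nonneg_right ?_ ht0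
      simp only [St] at this
      nlinarith
    have hc : Filter.Tendsto (fun t : ℝ => -v.2 + M * ∑ x ∈ X, m x + t * ‖v.1‖ ^ 2)
        (nhdsWithin (0 : ℝ) (Set.Ioi 0)) (nhds (-v.2 + M * ∑ x ∈ X, m x)) := by
      have : Continuous fun t : ℝ => -v.2 + M * ∑ x ∈ X, m x + t * ‖v.1‖ ^ 2 := by fun_prop
      simpa using (this.tendsto 0).mono_left nhdsWithin_le_nhds
    have := ge_of_tendsto hc hdir
    rw [hm] at this
    rw [hΛ]
    linarith)
  -- Multipliers extended from the sphere to `X` by the slopes of the penalty. Evaluating the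
  -- resulting identity at `(0, 1)` and at `(d, 0)` yields the sum and the center condition.
  let ρ' : EuclideanSpace ℝ (Fin n) → ℝ := fun x =>
    if S.power w x < 0 then -M else if x ∈ A then ρ x else 0
  have hρ' : ∀ v, ∑ x ∈ X, ρ' x * ℓ x v = v.2 := by
    intro v
    have h1 : ∑ x ∈ X, ρ' x * ℓ x v =
        -M * ∑ x ∈ X with S.power w x < 0, ℓ x v + ∑ x ∈ A, ρ x * ℓ x v := by
      rw [Finset.mul_sum, Finset.sum_filter, ← Finset.inter_eq_right.2 hAX,
        ← Finset.sum_ite_mem, ← Finset.sum_add_distrib]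
      refine Finset.sum_congr rfl fun x hx => ?_
      by_cases h : S.power w x < 0
      · have : x ∉ A := fun h' => h.ne (mem_onFace.1 h').2
        simp [ρ', h, this]
      · simp [ρ', h]
    have h2 := hρ v
    rw [hΛ] at h2
    rw [h1]
    linarith
  have hsum : ∑ x ∈ X, ρ' x = 1 := by simpa [hℓ] using hρ' (0, 1)
  have hA : ∀ x ∈ X, ρ' x = -M ∨ ρ' x = 0 ∨ (x ∈ A ∧ ρ' x = ρ x) := by
    intro x _
    simp only [ρ']
    split_ifs <;> simp [*]
  refine ⟨ρ', ⟨⟨hsum, ?_, ?_, ?_⟩, hS, ?_, ?_⟩⟩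
  · refine ext_inner_right ℝ fun d => ?_
    have h2 := hρ' (d, 0)
    simp only [hℓ, inner_sub_left, zero_add] at h2
    have h3 : ∑ x ∈ X, ρ' x * (2 * (inner ℝ S.center d - inner ℝ x d))
        = (∑ x ∈ X, ρ' x) * (2 * inner ℝ S.center d) - 2 * ∑ x ∈ X, ρ' x * inner ℝ x d := by
      rw [Finset.sum_mul, Finset.mul_sum, ← Finset.sum_sub_distrib]
      exact Finset.sum_congr rfl fun x _ => by ring
    rw [h3, hsum] at h2
    simp only [sum_inner, real_inner_smul_left]
    linarith
  · intro x _ hpos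
    have : x ∉ A := fun h' => hpos.ne' (mem_onFace.1 h').2
    simp [ρ', this, hpos.not_gt]
  · intro x _ hneg
    simp [ρ', hneg]
  · intro x hx hpos
    rcases hA x hx with h | h | ⟨hxA, h⟩
    · linarith
    · linarith
    · exact hρQ x hxA (h ▸ hpos)
  · intro x hx hneg
    rcases hA x hx with h | h | ⟨hxA, h⟩
    · linarith
    · linarith
    · exact hρE x hxA (h ▸ hneg)

theorem exists_minimal_sphere {M : ℝ} (hM : 0 ≤ M)
    {E Q : Finset (EuclideanSpace ℝ (Fin n))} (hQ : Q.Nonempty)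
    (hne : ∃ T, IsFeasible w E Q T) :
    ∃ S, IsFeasible w E Q S ∧
      ∀ T, IsFeasible w E Q T → penalizedSqRadius X w M S ≤ penalizedSqRadius X w M T := by
  obtain ⟨T₀, hT₀⟩ := hne
  obtain ⟨q, hq⟩ := hQ
  let sph : EuclideanSpace ℝ (Fin n) × ℝ → WeightedSphere n := fun p => ⟨p.1, p.2⟩
  have hpow : ∀ x, Continuous fun p => (sph p).power w x := by
    intro x
    simp only [sph, WeightedSphere.power]
    fun_prop
  have hpen : Continuous fun p => penalizedSqRadius X w M (sph p) := by
    have := fun x => hpow x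
    unfold penalizedSqRadius
    refine Continuous.add continuous_snd (continuous_const.mul ?_)
    exact continuous_finsetSum _ fun x _ => continuous_const.max (hpow x).neg
  let K : Set (EuclideanSpace ℝ (Fin n) × ℝ) :=
    {p | IsFeasible w E Q (sph p) ∧ penalizedSqRadius X w M (sph p) ≤ penalizedSqRadius X w M T₀}
  have hclosed : IsClosed K := by
    have : K = (⋂ x ∈ Q, {p | (sph p).power w x ≤ 0}) ∩ (⋂ x ∈ E, {p | 0 ≤ (sph p).power w x}) ∩
        {p | penalizedSqRadius X w M (sph p) ≤ penalizedSqRadius X w M T₀} := by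
      ext p; simp [K, IsFeasible]
    rw [this]
    refine IsClosed.inter (IsClosed.inter ?_ ?_) (isClosed_le hpen continuous_const)
    · exact isClosed_biInter fun x _ => isClosed_le (hpow x) continuous_const
    · exact isClosed_biInter fun x _ => isClosed_le continuous_const (hpow x)
  set F := penalizedSqRadius X w M T₀
  -- Including the single point `q` bounds the radius from below and, together with the bound `F` on
  -- the penalized radius, confines the center.
  have hsub : K ⊆ Metric.closedBall q (|F + w q| + 1) ×ˢ Set.Icc (-w q) F := by
    rintro ⟨z, s⟩ ⟨hf, hF⟩
    have h1 := hf.1 q hq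
    have h2 : s ≤ F := by
      refine le_trans ?_ hF
      have : 0 ≤ M * ∑ x ∈ X, max 0 (-(sph (z, s)).power w x) :=
        mul_nonneg hM (Finset.sum_nonneg fun x _ => le_max_left _ _)
      simp only [penalizedSqRadius, sph] at this ⊢
      linarith
    simp only [sph, WeightedSphere.power] at h1
    refine ⟨?_, by nlinarith [sq_nonneg (dist z q)], h2⟩
    rw [Metric.mem_closedBall]
    refine abs_le_of_sq_le_sq' ?_ (by positivity) |>.2
    nlinarith [le_abs_self (F + w q), abs_nonneg (F + w q)]
  have hcomp : IsCompact K :=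
    ((isCompact_closedBall _ _).prod isCompact_Icc).of_isClosed_subset hclosed hsub
  obtain ⟨p, hp, hmin⟩ := hcomp.exists_isMinOn ⟨(T₀.center, T₀.sqRadius), hT₀, le_rfl⟩
    hpen.continuousOn
  refine ⟨sph p, hp.1, fun T hT => ?_⟩
  rcases le_total (penalizedSqRadius X w M T) F with h | h
  · exact hmin (a := (T.center, T.sqRadius)) ⟨hT, h⟩
  · exact hp.2.trans h

theorem exists_isKKT (hX : InGeneralPosition X w) {M : ℝ} (hM : 0 ≤ M)
    {E Q : Finset (EuclideanSpace ℝ (Fin n))} (hEX : E ⊆ X) (hQX : Q ⊆ X) (hQ : Q.Nonempty)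
    (hne : ∃ T, IsFeasible w E Q T) : ∃ S ρ, IsKKT X w M E Q S ρ := by
  obtain ⟨S, hS, hmin⟩ := exists_minimal_sphere (X := X) hM hQ hne
  exact ⟨S, exists_isKKT_of_minimal hX hM hEX hQX hS hmin⟩

@[simp]
theorem penalizedSqRadius_zero (S : WeightedSphere n) :
    penalizedSqRadius X w 0 S = S.sqRadius := by
  simp [penalizedSqRadius]

theorem penalizedSqRadius_of_excludes {M : ℝ} {S : WeightedSphere n}
    (hS : ∀ x ∈ X, 0 ≤ S.power w x) : penalizedSqRadius X w M S = S.sqRadius := by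
  rw [penalizedSqRadius, Finset.sum_eq_zero fun x hx => max_eq_left (by linarith [hS x hx])]
  simp

theorem isFeasible_empty {Q : Finset (EuclideanSpace ℝ (Fin n))} {S : WeightedSphere n} :
    IsFeasible w ∅ Q S ↔ ∀ q ∈ Q, S.power w q ≤ 0 := by
  simp [IsFeasible]

theorem IsFeasible.mono {E P Q : Finset (EuclideanSpace ℝ (Fin n))} {S : WeightedSphere n}
    (h : IsFeasible w E Q S) (hPQ : P ⊆ Q) : IsFeasible w E P S :=
  ⟨fun q hq => h.1 q (hPQ hq), h.2⟩

theorem exists_isFeasible_empty (Q : Finset (EuclideanSpace ℝ (Fin n))) :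
    ∃ T, IsFeasible w ∅ Q T := by
  refine ⟨⟨0, ∑ q ∈ Q, |dist 0 q ^ 2 - w q|⟩, isFeasible_empty.2 fun q hq => ?_⟩
  have := Finset.single_le_sum (f := fun q => |dist 0 q ^ 2 - w q|)
    (fun q _ => abs_nonneg _) hq
  simp only [WeightedSphere.power]
  linarith [le_abs_self (dist 0 q ^ 2 - w q)]

theorem IsKKT.le {M : ℝ} {E Q : Finset (EuclideanSpace ℝ (Fin n))} {S T : WeightedSphere n}
    {ρ : EuclideanSpace ℝ (Fin n) → ℝ} (hM : 0 ≤ M) (h : IsKKT X w M E Q S ρ)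
    (hT : IsFeasible w E Q T) : penalizedSqRadius X w M S ≤ penalizedSqRadius X w M T := by
  linarith [h.add_le hM hT, sq_nonneg (dist T.center S.center)]

theorem IsKKT.unique {M : ℝ} {E Q : Finset (EuclideanSpace ℝ (Fin n))} {S T : WeightedSphere n}
    {ρ ρ' : EuclideanSpace ℝ (Fin n) → ℝ} (hM : 0 ≤ M) (h : IsKKT X w M E Q S ρ)
    (h' : IsKKT X w M E Q T ρ') : T = S :=
  h.eq_of_le hM h'.feasible (h'.le hM h.feasible)

theorem IsStationary.exists_pos {M : ℝ} {S : WeightedSphere n}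
    {ρ : EuclideanSpace ℝ (Fin n) → ℝ} (h : IsStationary X w M S ρ) : ∃ x ∈ X, 0 < ρ x := by
  by_contra! hle
  linarith [h.sum_eq, Finset.sum_nonpos hle]

/-- A point of nonpositive coefficient that is not strictly outside the sphere can be added to or
removed from the points that are to be included. -/
theorem IsKKT.flip {M : ℝ} {E Q Q' : Finset (EuclideanSpace ℝ (Fin n))} {S : WeightedSphere n}
    {ρ : EuclideanSpace ℝ (Fin n) → ℝ} (h : IsKKT X w M E Q S ρ) {x : EuclideanSpace ℝ (Fin n)}
    (hx : S.power w x ≤ 0) (hρ : ρ x ≤ 0) (hQ' : ∀ y, y ≠ x → (y ∈ Q' ↔ y ∈ Q)) :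
    IsKKT X w M E Q' S ρ := by
  refine ⟨h.toIsStationary, ⟨fun q hq => ?_, h.feasible.2⟩, fun y hy hpos => ?_, h.back⟩
  · by_cases hqx : q = x
    · exact hqx ▸ hx
    · exact h.feasible.1 q ((hQ' q hqx).1 hq)
  · refine (hQ' y ?_).2 (h.front y hy hpos)
    rintro rfl
    linarith

/-- Exact penalty: if `M` exceeds all multipliers of the problems with the hard constraint to
exclude `X`, then no coefficient is below `-M`, and the hard minimizers satisfy the conditions of
the soft problem. -/
theorem exists_penalty (hX : InGeneralPosition X w) :
    ∃ M : ℝ, 0 < M ∧ ∀ Q ⊆ X, Q.Nonempty → (∃ T, IsFeasible w X Q T) →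
      ∃ S ρ, IsFeasible w X Q S ∧ IsKKT X w M ∅ Q S ρ := by
  have hex : ∀ Q : Finset (EuclideanSpace ℝ (Fin n)), ∃ ρ : EuclideanSpace ℝ (Fin n) → ℝ,
      Q ⊆ X → Q.Nonempty → (∃ T, IsFeasible w X Q T) → ∃ S, IsKKT X w 0 X Q S ρ := by
    intro Q
    by_cases h : Q ⊆ X ∧ Q.Nonempty ∧ ∃ T, IsFeasible w X Q T
    · obtain ⟨S, ρ, hS⟩ := exists_isKKT hX le_rfl subset_rfl h.1 h.2.1 h.2.2
      exact ⟨ρ, fun _ _ _ => ⟨S, hS⟩⟩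
    · exact ⟨0, fun h1 h2 h3 => absurd ⟨h1, h2, h3⟩ h⟩
  choose ρ hρ using hex
  let M : ℝ := 1 + ∑ Q ∈ X.powerset, ∑ x ∈ X, |ρ Q x|
  have hle : ∀ Q ⊆ X, ∀ x ∈ X, |ρ Q x| < M := by
    intro Q hQ x hx
    have h1 := Finset.single_le_sum (f := fun x => |ρ Q x|) (fun x _ => abs_nonneg _) hx
    have h2 := Finset.single_le_sum (f := fun Q => ∑ x ∈ X, |ρ Q x|)
      (fun Q _ => Finset.sum_nonneg fun x _ => abs_nonneg _) (Finset.mem_powerset.2 hQ)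
    simp only [M]
    linarith
  refine ⟨M, ?_, fun Q hQX hQ hT => ?_⟩
  · have : 0 ≤ ∑ Q ∈ X.powerset, ∑ x ∈ X, |ρ Q x| :=
      Finset.sum_nonneg fun Q _ => Finset.sum_nonneg fun x _ => abs_nonneg _
    simp only [M]
    linarith
  · obtain ⟨S, hS⟩ := hρ Q hQX hQ hT
    refine ⟨S, ρ Q, hS.feasible, ⟨⟨hS.sum_eq, hS.center_eq, hS.of_pos, fun x hx hneg => ?_⟩,
      isFeasible_empty.2 hS.feasible.1, hS.front, fun x hx hlt => ?_⟩⟩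
    · exact absurd hneg (hS.feasible.2 x hx).not_gt
    · linarith [hle Q hQX x hx, neg_abs_le (ρ Q x)]

/-! ### The two spheres of a simplex, and the four complexes in terms of them. -/

/-- `C Q` is the smallest sphere that includes `Q`, and `D Q` is the smallest one when the
violation of the condition to exclude `X` is penalized so much that `D Q` excludes `X` if any
sphere that includes `Q` does. -/
structure IsSphereSystem (X : Finset (EuclideanSpace ℝ (Fin n)))
    (w : EuclideanSpace ℝ (Fin n) → ℝ) (M : ℝ)
    (C D : Finset (EuclideanSpace ℝ (Fin n)) → WeightedSphere n) : Prop where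
  pos : 0 < M
  cech : ∀ Q ⊆ X, Q.Nonempty → ∃ ρ, IsKKT X w 0 ∅ Q (C Q) ρ
  penalized : ∀ Q ⊆ X, Q.Nonempty → ∃ ρ, IsKKT X w M ∅ Q (D Q) ρ
  excludes : ∀ Q ⊆ X, Q.Nonempty → (∃ T, IsFeasible w X Q T) → ∀ x ∈ X, 0 ≤ (D Q).power w x

theorem exists_isSphereSystem (hX : InGeneralPosition X w) :
    ∃ M C D, IsSphereSystem X w M C D := by
  obtain ⟨M, hM, hMX⟩ := exists_penalty hX
  have hex : ∀ (M : ℝ), 0 ≤ M → ∀ Q, ∃ S, Q ⊆ X → Q.Nonempty → ∃ ρ, IsKKT X w M ∅ Q S ρ := by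
    intro M hM Q
    by_cases h : Q ⊆ X ∧ Q.Nonempty
    · obtain ⟨S, hS⟩ :=
        exists_isKKT hX hM (Finset.empty_subset X) h.1 h.2 (exists_isFeasible_empty Q)
      exact ⟨S, fun _ _ => hS⟩
    · exact ⟨⟨0, 0⟩, fun h1 h2 => absurd ⟨h1, h2⟩ h⟩
  choose C hC using hex 0 le_rfl
  choose D hD using hex M hM.le
  refine ⟨M, C, D, hM, hC, hD, fun Q hQX hQ hT => ?_⟩
  obtain ⟨S, ρ, hS, hKKT⟩ := hMX Q hQX hQ hT
  obtain ⟨ρ', hKKT'⟩ := hD Q hQX hQ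
  rw [hKKT.unique hM.le hKKT']
  exact hS.2

theorem mem_cech_iff {s : ℝ} {Q : Finset (EuclideanSpace ℝ (Fin n))} :
    Q ∈ (cech X w s).faces ↔
      Q.Nonempty ∧ Q ⊆ X ∧ ∃ T, IsFeasible w ∅ Q T ∧ T.sqRadius ≤ s := by
  refine and_congr_right fun _ => and_congr_right fun _ => ⟨?_, ?_⟩
  · rintro ⟨y, hy⟩
    simp only [Set.mem_iInter, weightedBall, Set.mem_ofPred_eq] at hy
    refine ⟨⟨y, s⟩, isFeasible_empty.2 fun q hq => ?_, le_rfl⟩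
    simp only [WeightedSphere.power]
    linarith [hy q hq]
  · rintro ⟨T, hT, hs⟩
    refine ⟨T.center, ?_⟩
    simp only [Set.mem_iInter, weightedBall, Set.mem_ofPred_eq]
    intro q hq
    have := hT.1 q hq
    simp only [WeightedSphere.power] at this
    linarith

theorem mem_delaunay_iff {s : ℝ} {Q : Finset (EuclideanSpace ℝ (Fin n))} :
    Q ∈ (delaunay X w s).faces ↔
      Q.Nonempty ∧ Q ⊆ X ∧ ∃ T, IsFeasible w X Q T ∧ T.sqRadius ≤ s := by
  refine and_congr_right fun hQ => and_congr_right fun hQX => ⟨?_, ?_⟩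
  · rintro ⟨y, hy⟩
    simp only [Set.mem_iInter, weightedBall, voronoiDomain, Set.mem_ofPred_eq, Set.mem_inter_iff]
      at hy
    obtain ⟨q, hq⟩ := hQ
    refine ⟨⟨y, dist y q ^ 2 - w q⟩, ⟨fun p hp => ?_, fun p hp => ?_⟩, ?_⟩
    · have := (hy p hp).2 q (hQX hq)
      simp only [WeightedSphere.power]
      linarith
    · have := (hy q hq).2 p hp
      simp only [WeightedSphere.power]
      linarith
    · linarith [(hy q hq).1]
  · rintro ⟨T, hT, hs⟩
    refine ⟨T.center, ?_⟩
    simp only [Set.mem_iInter, weightedBall, voronoiDomain, Set.mem_ofPred_eq, Set.mem_inter_iff]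
    intro q hq
    have h1 := hT.1 q hq
    simp only [WeightedSphere.power] at h1
    refine ⟨by linarith, fun p hp => ?_⟩
    have h2 := hT.2 p hp
    simp only [WeightedSphere.power] at h2
    linarith

theorem mem_delaunayTriangulation_iff {Q : Finset (EuclideanSpace ℝ (Fin n))} :
    Q ∈ (delaunayTriangulation X w).faces ↔
      Q.Nonempty ∧ Q ⊆ X ∧ ∃ T, IsFeasible w X Q T := by
  refine and_congr_right fun hQ => and_congr_right fun hQX => ⟨?_, ?_⟩
  · rintro ⟨y, hy⟩
    simp only [Set.mem_iInter, voronoiDomain, Set.mem_ofPred_eq] at hy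
    obtain ⟨q, hq⟩ := hQ
    refine ⟨⟨y, dist y q ^ 2 - w q⟩, fun p hp => ?_, fun p hp => ?_⟩
    · have := hy p hp q (hQX hq)
      simp only [WeightedSphere.power]
      linarith
    · have := hy q hq p hp
      simp only [WeightedSphere.power]
      linarith
  · rintro ⟨T, hT⟩
    refine ⟨T.center, ?_⟩
    simp only [Set.mem_iInter, voronoiDomain, Set.mem_ofPred_eq]
    intro q hq p hp
    have h1 := hT.1 q hq
    have h2 := hT.2 p hp
    simp only [WeightedSphere.power] at h1 h2
    linarith

theorem isDelaunaySphere_iff {Q : Finset (EuclideanSpace ℝ (Fin n))} {S : WeightedSphere n} :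
    IsDelaunaySphere X w Q S ↔
      IsFeasible w X Q S ∧ ∀ T, IsFeasible w X Q T → S.sqRadius ≤ T.sqRadius := by
  simp only [IsDelaunaySphere, IsFeasible, WeightedSphere.includes_iff,
    WeightedSphere.excludes_iff, and_imp]

theorem mem_frontFace (hX : InGeneralPosition X w) {M : ℝ} {S : WeightedSphere n}
    {ρ : EuclideanSpace ℝ (Fin n) → ℝ} (h : IsStationary X w M S ρ)
    (hS : ∀ x ∈ X, 0 ≤ S.power w x) {x : EuclideanSpace ℝ (Fin n)} :
    x ∈ frontFace X w S ↔ x ∈ X ∧ 0 < ρ x := by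
  obtain ⟨h1, h2⟩ := h.sum_onFace hS
  classical
  simp only [frontFace, Finset.mem_filter]
  constructor
  · rintro ⟨hx, ρ', h1', h2', hpos⟩
    refine ⟨(mem_onFace.1 hx).1, ?_⟩
    have : ρ x - ρ' x = 0 := by
      refine eq_zero_of_sum_onFace (ρ := fun x => ρ x - ρ' x) hX ?_ ?_ x hx
      · rw [Finset.sum_sub_distrib, h1, h1', sub_self]
      · simp only [sub_smul, Finset.sum_sub_distrib, h2, h2', sub_self]
    linarith
  · rintro ⟨hx, hpos⟩
    refine ⟨mem_onFace.2 ⟨hx, ?_⟩, ρ, h1, h2, hpos⟩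
    by_contra hne
    exact hpos.ne' (h.of_pos x hx ((hS x hx).lt_of_ne (Ne.symm hne)))

variable {M : ℝ} {C D : Finset (EuclideanSpace ℝ (Fin n)) → WeightedSphere n}

theorem delaunay_le_delaunayCech {s : ℝ} : delaunay X w s ≤ delaunayCech X w s := by
  intro Q hQ
  obtain ⟨hQne, hQX, T, hT, hs⟩ := mem_delaunay_iff.1 hQ
  exact ⟨mem_delaunayTriangulation_iff.2 ⟨hQne, hQX, T, hT⟩,
    mem_cech_iff.2 ⟨hQne, hQX, T, isFeasible_empty.2 hT.1, hs⟩⟩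

namespace IsSphereSystem

theorem sqRadius_cech_le (h : IsSphereSystem X w M C D)
    {Q : Finset (EuclideanSpace ℝ (Fin n))} (hQX : Q ⊆ X) (hQ : Q.Nonempty)
    {T : WeightedSphere n} (hT : IsFeasible w ∅ Q T) : (C Q).sqRadius ≤ T.sqRadius := by
  obtain ⟨γ, hγ⟩ := h.cech Q hQX hQ
  simpa using hγ.le le_rfl hT

theorem eq_cech_of_isKKT (h : IsSphereSystem X w M C D)
    {Q : Finset (EuclideanSpace ℝ (Fin n))} (hQX : Q ⊆ X) (hQ : Q.Nonempty)
    {S : WeightedSphere n} {ρ : EuclideanSpace ℝ (Fin n) → ℝ} (hS : IsKKT X w 0 ∅ Q S ρ) :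
    C Q = S := by
  obtain ⟨γ, hγ⟩ := h.cech Q hQX hQ
  exact hS.unique le_rfl hγ

theorem eq_penalized_of_isKKT (h : IsSphereSystem X w M C D)
    {Q : Finset (EuclideanSpace ℝ (Fin n))} (hQX : Q ⊆ X) (hQ : Q.Nonempty)
    {S : WeightedSphere n} {ρ : EuclideanSpace ℝ (Fin n) → ℝ} (hS : IsKKT X w M ∅ Q S ρ) :
    D Q = S := by
  obtain ⟨δ, hδ⟩ := h.penalized Q hQX hQ
  exact hS.unique h.pos.le hδ

theorem mono (h : IsSphereSystem X w M C D) {P Q : Finset (EuclideanSpace ℝ (Fin n))}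
    (hP : P.Nonempty) (hPQ : P ⊆ Q) (hQX : Q ⊆ X) :
    (C P).sqRadius ≤ (C Q).sqRadius ∧
    penalizedSqRadius X w M (D P) ≤ penalizedSqRadius X w M (D Q) ∧
    ((C Q).sqRadius ≤ (C P).sqRadius → C P = C Q) ∧
    (penalizedSqRadius X w M (D Q) ≤ penalizedSqRadius X w M (D P) → D P = D Q) := by
  obtain ⟨γ, hγ⟩ := h.cech P (hPQ.trans hQX) hP
  obtain ⟨δ, hδ⟩ := h.penalized P (hPQ.trans hQX) hP
  obtain ⟨γ', hγ'⟩ := h.cech Q hQX (hP.mono hPQ)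
  obtain ⟨δ', hδ'⟩ := h.penalized Q hQX (hP.mono hPQ)
  refine ⟨by simpa using hγ.le le_rfl (hγ'.feasible.mono hPQ),
    hδ.le h.pos.le (hδ'.feasible.mono hPQ), fun hle => ?_, fun hle => ?_⟩
  · exact (hγ.eq_of_le le_rfl (hγ'.feasible.mono hPQ) (by simpa using hle)).symm
  · exact (hδ.eq_of_le h.pos.le (hδ'.feasible.mono hPQ) hle).symm

theorem mem_cech (h : IsSphereSystem X w M C D) {s : ℝ}
    {Q : Finset (EuclideanSpace ℝ (Fin n))} (hQX : Q ⊆ X) (hQ : Q.Nonempty) :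
    Q ∈ (CollapsingHierarchy.cech X w s).faces ↔ (C Q).sqRadius ≤ s := by
  rw [mem_cech_iff]
  constructor
  · rintro ⟨_, _, T, hT, hs⟩
    exact (h.sqRadius_cech_le hQX hQ hT).trans hs
  · intro hs
    obtain ⟨γ, hγ⟩ := h.cech Q hQX hQ
    exact ⟨hQ, hQX, C Q, hγ.feasible, hs⟩

theorem isFeasible (h : IsSphereSystem X w M C D)
    {Q : Finset (EuclideanSpace ℝ (Fin n))} (hQX : Q ⊆ X) (hQ : Q.Nonempty)
    (hex : ∀ x ∈ X, 0 ≤ (D Q).power w x) : IsFeasible w X Q (D Q) := by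
  obtain ⟨δ, hδ⟩ := h.penalized Q hQX hQ
  exact ⟨hδ.feasible.1, hex⟩

theorem mem_delaunayTriangulation (h : IsSphereSystem X w M C D)
    {Q : Finset (EuclideanSpace ℝ (Fin n))} (hQX : Q ⊆ X) (hQ : Q.Nonempty) :
    Q ∈ (delaunayTriangulation X w).faces ↔ ∀ x ∈ X, 0 ≤ (D Q).power w x := by
  rw [mem_delaunayTriangulation_iff]
  exact ⟨fun hT => h.excludes Q hQX hQ hT.2.2, fun hex => ⟨hQ, hQX, D Q, h.isFeasible hQX hQ hex⟩⟩

theorem isDelaunaySphere_iff_eq (h : IsSphereSystem X w M C D)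
    {Q : Finset (EuclideanSpace ℝ (Fin n))} (hQX : Q ⊆ X) (hQ : Q.Nonempty)
    (hex : ∀ x ∈ X, 0 ≤ (D Q).power w x) {S : WeightedSphere n} :
    IsDelaunaySphere X w Q S ↔ S = D Q := by
  rw [isDelaunaySphere_iff]
  obtain ⟨δ, hδ⟩ := h.penalized Q hQX hQ
  constructor
  · rintro ⟨hS, hmin⟩
    refine hδ.eq_of_le h.pos.le (isFeasible_empty.2 hS.1) ?_
    rw [penalizedSqRadius_of_excludes hS.2, penalizedSqRadius_of_excludes hex]
    exact hmin _ (h.isFeasible hQX hQ hex)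
  · rintro rfl
    refine ⟨h.isFeasible hQX hQ hex, fun T hT => ?_⟩
    rw [← penalizedSqRadius_of_excludes hex, ← penalizedSqRadius_of_excludes hT.2]
    exact hδ.le h.pos.le (isFeasible_empty.2 hT.1)

theorem mem_delaunay (h : IsSphereSystem X w M C D) {s : ℝ}
    {Q : Finset (EuclideanSpace ℝ (Fin n))} (hQX : Q ⊆ X) (hQ : Q.Nonempty) :
    Q ∈ (delaunay X w s).faces ↔
      (∀ x ∈ X, 0 ≤ (D Q).power w x) ∧ (D Q).sqRadius ≤ s := by
  rw [mem_delaunay_iff]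
  constructor
  · rintro ⟨_, _, T, hT, hs⟩
    have hex := h.excludes Q hQX hQ ⟨T, hT⟩
    have := (isDelaunaySphere_iff.1 ((h.isDelaunaySphere_iff_eq hQX hQ hex).2 rfl)).2 T hT
    exact ⟨hex, this.trans hs⟩
  · rintro ⟨hex, hs⟩
    exact ⟨hQ, hQX, D Q, h.isFeasible hQX hQ hex, hs⟩

/-- For a sphere that excludes `X`, the optimality conditions for `P` say exactly that `P` contains
the points of positive coefficient and consists of points on the sphere. So Delaunay intervals are
level sets of `D`. -/
theorem mem_interval (hX : InGeneralPosition X w) (h : IsSphereSystem X w M C D)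
    {P Q : Finset (EuclideanSpace ℝ (Fin n))} (hQX : Q ⊆ X) (hQ : Q.Nonempty)
    (hex : ∀ x ∈ X, 0 ≤ (D Q).power w x) :
    P ∈ Set.Icc (frontFace X w (D Q)) (onFace X w (D Q)) ↔
      P ⊆ X ∧ P.Nonempty ∧ D P = D Q := by
  obtain ⟨δ, hδ⟩ := h.penalized Q hQX hQ
  constructor
  · rintro ⟨h1, h2⟩
    have hfront : ∀ x ∈ X, 0 < δ x → x ∈ P := fun x hx hpos =>
      h1 ((mem_frontFace hX hδ.toIsStationary hex).2 ⟨hx, hpos⟩)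
    obtain ⟨x, hx, hpos⟩ := hδ.exists_pos
    have hPX : P ⊆ X := fun y hy => (mem_onFace.1 (h2 hy)).1
    have hP : P.Nonempty := ⟨x, hfront x hx hpos⟩
    exact ⟨hPX, hP, h.eq_penalized_of_isKKT hPX hP ⟨hδ.toIsStationary,
      isFeasible_empty.2 fun q hq => (mem_onFace.1 (h2 hq)).2.le, hfront, hδ.back⟩⟩
  · rintro ⟨hPX, hP, hPQ⟩
    obtain ⟨δ', hδ'⟩ := h.penalized P hPX hP
    rw [hPQ] at hδ'
    constructor
    · intro x hx
      obtain ⟨hxX, hpos⟩ := (mem_frontFace hX hδ'.toIsStationary hex).1 hx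
      exact hδ'.front x hxX hpos
    · intro x hx
      exact mem_onFace.2 ⟨hPX hx, le_antisymm (hδ'.feasible.1 x hx) (hex x (hPX hx))⟩

theorem interval_mem (h : IsSphereSystem X w M C D)
    {Q : Finset (EuclideanSpace ℝ (Fin n))} (hQX : Q ⊆ X) (hQ : Q.Nonempty)
    (hex : ∀ x ∈ X, 0 ≤ (D Q).power w x) :
    Set.Icc (frontFace X w (D Q)) (onFace X w (D Q)) ∈ delaunayGradient X w :=
  ⟨Q, (h.mem_delaunayTriangulation hQX hQ).2 hex, D Q,
    (h.isDelaunaySphere_iff_eq hQX hQ hex).2 rfl, rfl⟩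

theorem of_mem_delaunayGradient (hX : InGeneralPosition X w) (h : IsSphereSystem X w M C D)
    {I : Set (Finset (EuclideanSpace ℝ (Fin n)))} (hI : I ∈ delaunayGradient X w)
    {P : Finset (EuclideanSpace ℝ (Fin n))} (hP : P ∈ I) :
    P ⊆ X ∧ P.Nonempty ∧ (∀ x ∈ X, 0 ≤ (D P).power w x) ∧
      I = Set.Icc (frontFace X w (D P)) (onFace X w (D P)) := by
  obtain ⟨Q, hQdel, S, hS, rfl⟩ := hI
  obtain ⟨hQ, hQX, _⟩ := mem_delaunayTriangulation_iff.1 hQdel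
  have hex := (h.mem_delaunayTriangulation hQX hQ).1 hQdel
  obtain rfl := (h.isDelaunaySphere_iff_eq hQX hQ hex).1 hS
  obtain ⟨hPX, hPne, hPQ⟩ := (h.mem_interval hX hQX hQ hex).1 hP
  rw [hPQ]
  exact ⟨hPX, hPne, hex, rfl⟩

theorem penalized_eq_of_mem (hX : InGeneralPosition X w) (h : IsSphereSystem X w M C D)
    {I : Set (Finset (EuclideanSpace ℝ (Fin n)))} (hI : I ∈ delaunayGradient X w)
    {P Q : Finset (EuclideanSpace ℝ (Fin n))} (hP : P ∈ I) (hQ : Q ∈ I) : D P = D Q := by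
  obtain ⟨hQX, hQne, hex, rfl⟩ := h.of_mem_delaunayGradient hX hI hQ
  exact ((h.mem_interval hX hQX hQne hex).1 hP).2.2

/-- `D` is constant on intervals and its radius is monotone under inclusion, so radii do not
decrease along arcs. -/
theorem sqRadius_le_of_path (hX : InGeneralPosition X w) (h : IsSphereSystem X w M C D) {s : ℝ}
    {I J : Set (Finset (EuclideanSpace ℝ (Fin n)))} (hJ : ∀ Q ∈ J, (D Q).sqRadius ≤ s)
    (hIJ : Relation.ReflTransGen (GradientArc X w) I J) : ∀ Q ∈ I, (D Q).sqRadius ≤ s := by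
  induction hIJ using Relation.ReflTransGen.head_induction_on with
  | refl => exact hJ
  | head harc _ ih =>
    intro Q hQ
    obtain ⟨hI, hI', P, hP, P', hP', hsub⟩ := harc
    rw [h.penalized_eq_of_mem hX hI hQ hP]
    obtain ⟨hPX, hPne, hex, _⟩ := h.of_mem_delaunayGradient hX hI hP
    obtain ⟨hPX', hPne', hex', _⟩ := h.of_mem_delaunayGradient hX hI' hP'
    have := (h.mono hPne hsub hPX').2.1
    rw [penalizedSqRadius_of_excludes hex, penalizedSqRadius_of_excludes hex'] at this
    exact this.trans (ih P' hP')

theorem mem_wrapSimplices (hX : InGeneralPosition X w) (h : IsSphereSystem X w M C D) {s : ℝ}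
    {Q : Finset (EuclideanSpace ℝ (Fin n))} (hQX : Q ⊆ X) (hQ : Q.Nonempty) :
    Q ∈ wrapSimplices X w s ↔ (∀ x ∈ X, 0 ≤ (D Q).power w x) ∧
      Set.Icc (frontFace X w (D Q)) (onFace X w (D Q)) ∈
        lowerSet X w (singularIntervals X w s) := by
  constructor
  · rintro ⟨I, hI, hQI⟩
    obtain ⟨_, _, hex, rfl⟩ := h.of_mem_delaunayGradient hX hI.1 hQI
    exact ⟨hex, hI⟩
  · rintro ⟨hex, hI⟩
    exact ⟨_, hI, (h.mem_interval hX hQX hQ hex).2 ⟨hQX, hQ, rfl⟩⟩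

theorem nonempty_of_mem_wrapSimplices (hX : InGeneralPosition X w) (h : IsSphereSystem X w M C D)
    {s : ℝ} {Q : Finset (EuclideanSpace ℝ (Fin n))} (hQ : Q ∈ wrapSimplices X w s) :
    Q ⊆ X ∧ Q.Nonempty := by
  obtain ⟨I, hI, hQI⟩ := hQ
  obtain ⟨hQX, hQne, _⟩ := h.of_mem_delaunayGradient hX hI.1 hQI
  exact ⟨hQX, hQne⟩

theorem wrapSimplices_subset (hX : InGeneralPosition X w) (h : IsSphereSystem X w M C D) {s : ℝ} :
    wrapSimplices X w s ⊆ (delaunay X w s).faces := by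
  intro Q hQ
  obtain ⟨hQX, hQne⟩ := h.nonempty_of_mem_wrapSimplices hX hQ
  obtain ⟨hex, hI, J, hJ, hpath⟩ := (h.mem_wrapSimplices hX hQX hQne).1 hQ
  refine (h.mem_delaunay hQX hQne).2 ⟨hex, h.sqRadius_le_of_path hX (fun P hP => ?_) hpath Q
    ((h.mem_interval hX hQX hQne hex).2 ⟨hQX, hQne, rfl⟩)⟩
  obtain ⟨hJgrad, R, S, rfl, hS, hs⟩ := hJ
  have hPR : P = R := hP
  subst hPR
  obtain ⟨hPX, hPne, hPex, _⟩ := h.of_mem_delaunayGradient hX hJgrad hP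
  rwa [← (h.isDelaunaySphere_iff_eq hPX hPne hPex).1 hS]

theorem wrapSimplices_isRelLowerSet (hX : InGeneralPosition X w) (h : IsSphereSystem X w M C D)
    {s : ℝ} : IsRelLowerSet (wrapSimplices X w s) Finset.Nonempty := by
  intro Q hQ
  obtain ⟨hQX, hQne⟩ := h.nonempty_of_mem_wrapSimplices hX hQ
  refine ⟨hQne, fun P hPQ hP => ?_⟩
  have hPX : P ⊆ X := hPQ.trans hQX
  obtain ⟨hex, hI, J, hJ, hpath⟩ := (h.mem_wrapSimplices hX hQX hQne).1 hQ
  have hPex := h.excludes P hPX hP ⟨D Q, (h.isFeasible hQX hQne hex).mono hPQ⟩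
  have hPI := h.interval_mem hPX hP hPex
  refine (h.mem_wrapSimplices hX hPX hP).2 ⟨hPex, hPI, J, hJ, Relation.ReflTransGen.head ?_ hpath⟩
  exact ⟨hPI, hI, P, (h.mem_interval hX hPX hP hPex).2 ⟨hPX, hP, rfl⟩, Q,
    (h.mem_interval hX hQX hQne hex).2 ⟨hQX, hQne, rfl⟩, hPQ⟩

end IsSphereSystem

/-! ### Flips, critical simplices and the common gradient. -/

/-- The point `x` of `X` lies strictly inside `S` and has a negative coefficient with respect to
`T`. -/
def IsFlippable (X : Finset (EuclideanSpace ℝ (Fin n))) (w : EuclideanSpace ℝ (Fin n) → ℝ)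
    (M : ℝ) (S T : WeightedSphere n) (x : EuclideanSpace ℝ (Fin n)) : Prop :=
  x ∈ X ∧ S.power w x < 0 ∧ ∃ ρ, IsStationary X w M T ρ ∧ ρ x < 0

namespace IsSphereSystem

theorem flip (hX : InGeneralPosition X w) (h : IsSphereSystem X w M C D)
    {Q Q' : Finset (EuclideanSpace ℝ (Fin n))} (hQX : Q ⊆ X) (hQ : Q.Nonempty)
    {x : EuclideanSpace ℝ (Fin n)} (hx : IsFlippable X w M (C Q) (D Q) x) (hQX' : Q' ⊆ X)
    (hQ' : ∀ y, y ≠ x → (y ∈ Q' ↔ y ∈ Q)) : Q'.Nonempty ∧ C Q' = C Q ∧ D Q' = D Q := by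
  obtain ⟨hxX, hxC, ρ, hρ, hρx⟩ := hx
  obtain ⟨γ, hγ⟩ := h.cech Q hQX hQ
  obtain ⟨δ, hδ⟩ := h.penalized Q hQX hQ
  have hγx : γ x = 0 := by rw [hγ.of_neg x hxX hxC, neg_zero]
  have hδx : δ x < 0 := by rwa [hδ.toIsStationary.unique hX hρ x hxX]
  have hxD : (D Q).power w x ≤ 0 := by
    by_contra! hpos
    exact hδx.ne (hδ.of_pos x hxX hpos)
  have hγ' := hγ.flip hxC.le hγx.le hQ'
  have hδ' := hδ.flip hxD hδx.le hQ'
  -- The coefficients sum to `1`, so some point has a positive one and must belong to `Q'`.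
  obtain ⟨y, hy, hpos⟩ := hγ'.exists_pos
  have hne : Q'.Nonempty := ⟨y, hγ'.front y hy hpos⟩
  exact ⟨hne, h.eq_cech_of_isKKT hQX' hne hγ', h.eq_penalized_of_isKKT hQX' hne hδ'⟩

theorem critical (hX : InGeneralPosition X w) (h : IsSphereSystem X w M C D)
    {Q : Finset (EuclideanSpace ℝ (Fin n))} (hQX : Q ⊆ X) (hQ : Q.Nonempty)
    (hflip : ∀ x, ¬ IsFlippable X w M (C Q) (D Q) x) :
    C Q = D Q ∧ (∀ x ∈ X, 0 ≤ (D Q).power w x) ∧ onFace X w (D Q) = Q ∧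
      frontFace X w (D Q) = Q := by
  classical
  obtain ⟨γ, hγ⟩ := h.cech Q hQX hQ
  obtain ⟨δ, hδ⟩ := h.penalized Q hQX hQ
  have hM := h.pos
  -- Points with `0 < δ x` are in `Q`, hence included by `C Q`; points with `δ x < 0` are not
  -- strictly inside `C Q`, being unflippable.
  have hle : ∑ x ∈ X, δ x * (C Q).power w x ≤ 0 := by
    refine Finset.sum_nonpos fun x hx => ?_
    rcases lt_trichotomy (δ x) 0 with hlt | heq | hgt
    · refine mul_nonpos_of_nonpos_of_nonneg hlt.le ?_
      by_contra! hneg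
      exact hflip x ⟨hx, hneg, δ, hδ.toIsStationary, hlt⟩
    · simp [heq]
    · exact mul_nonpos_of_nonneg_of_nonpos hgt.le (hγ.feasible.1 x (hδ.front x hx hgt))
  have key := sqRadius_eq_add (w := w) hδ.sum_eq hδ.center_eq (C Q)
  rw [hδ.sum_mul_power] at key
  have hpen : 0 ≤ M * ∑ x ∈ X, max 0 (-(D Q).power w x) :=
    mul_nonneg hM.le (Finset.sum_nonneg fun x _ => le_max_left _ _)
  have hDC : D Q = C Q := by
    refine hγ.eq_of_le le_rfl hδ.feasible ?_
    rw [penalizedSqRadius_zero, penalizedSqRadius_zero]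
    nlinarith [sq_nonneg (dist (C Q).center (D Q).center)]
  have hex : ∀ x ∈ X, 0 ≤ (D Q).power w x := by
    intro x hx
    by_contra! hneg
    -- A point strictly inside the common sphere would have coefficient `-M < 0` and thus be
    -- flippable.
    exact hflip x ⟨hx, hDC ▸ hneg, δ, hδ.toIsStationary, by rw [hδ.of_neg x hx hneg]; linarith⟩
  obtain ⟨h1, h2⟩ := hγ.sum_onFace (hDC ▸ hex)
  rw [← hDC] at h1 h2 hγ
  -- The points of nonzero coefficient already represent the center, so by general position they are
  -- all the points on the sphere; being nonnegative for the Čech problem, their coefficients are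
  -- positive.
  let A := {x ∈ onFace X w (D Q) | γ x ≠ 0}
  have hA1 : ∑ x ∈ A, γ x = 1 := by rw [Finset.sum_filter_ne_zero, h1]
  have hA2 : ∑ x ∈ A, γ x • x = (D Q).center := by
    rw [← h2]
    refine Finset.sum_subset (Finset.filter_subset _ _) fun x hx hxA => ?_
    have : γ x = 0 := by
      by_contra hne
      exact hxA (Finset.mem_filter.2 ⟨hx, hne⟩)
    rw [this, zero_smul]
  have hsub := onFace_subset_of_center hX (Finset.filter_subset _ _)
    ((Finset.card_le_card (Finset.filter_subset _ _)).trans (card_onFace_le hX _)) hA1 hA2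
  have hpos : ∀ x ∈ onFace X w (D Q), 0 < γ x := by
    intro x hx
    refine lt_of_le_of_ne ?_ (Finset.mem_filter.1 (hsub hx)).2.symm
    by_contra! hneg
    exact absurd (hγ.back x (mem_onFace.1 hx).1 (by simpa using hneg)) (Finset.notMem_empty x)
  have hstat := hγ.toIsStationary
  have hQon : Q ⊆ onFace X w (D Q) := fun x hx =>
    mem_onFace.2 ⟨hQX hx, le_antisymm (hδ.feasible.1 x hx) (hex x (hQX hx))⟩
  have hon : onFace X w (D Q) ⊆ Q := fun x hx =>
    hγ.front x (mem_onFace.1 hx).1 (hpos x hx)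
  refine ⟨hDC.symm, hex, hon.antisymm hQon, ?_⟩
  ext x
  rw [mem_frontFace hX hstat hex]
  exact ⟨fun hx => hγ.front x hx.1 hx.2, fun hx => ⟨hQX hx, hpos x (hQon hx)⟩⟩

theorem exists_gradient (hX : InGeneralPosition X w) (h : IsSphereSystem X w M C D) :
    ∃ V : Set (Set (Finset (EuclideanSpace ℝ (Fin n)))), IsDiscreteGradient (fullSimplex X) V ∧
      (∀ A ∈ V, ∀ P ∈ A, ∀ Q ∈ A, C P = C Q ∧ D P = D Q) ∧
      ∀ Q, {Q} ∈ V → Q.Nonempty ∧ Q ⊆ X ∧ ∀ x, ¬ IsFlippable X w M (C Q) (D Q) x := by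
  classical
  let b : WeightedSphere n × WeightedSphere n → Option (EuclideanSpace ℝ (Fin n)) := fun p =>
    if hp : ∃ x, IsFlippable X w M p.1 p.2 x then some hp.choose else none
  have hbnone : ∀ p, b p = none → ∀ x, ¬ IsFlippable X w M p.1 p.2 x := by
    intro p hp x hx
    simp only [b, dif_pos (⟨x, hx⟩ : ∃ x, IsFlippable X w M p.1 p.2 x)] at hp
    exact Option.some_ne_none _ hp
  have hbsome : ∀ p x, b p = some x → IsFlippable X w M p.1 p.2 x := by
    intro p x hp
    by_cases hex : ∃ x, IsFlippable X w M p.1 p.2 x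
    · simp only [b, dif_pos hex, Option.some.injEq] at hp
      exact hp ▸ hex.choose_spec
    · simp only [b, dif_neg hex, reduceCtorEq] at hp
  obtain ⟨V, hV, hconst, hcrit⟩ := exists_gradient_of_flips X (fun Q => (C Q, D Q))
    -- Both summands are monotone, so equality of the sums along an inclusion forces equality of
    -- each, hence of both spheres.
    (fun p => p.1.sqRadius + penalizedSqRadius X w M p.2) b
    (by
      intro P Q hP hPQ hQX
      obtain ⟨h1, h2, h3, h4⟩ := h.mono hP hPQ hQX
      refine ⟨add_le_add h1 h2, fun heq => ?_⟩
      simp only at heq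
      rw [h3 (by linarith), h4 (by linarith)])
    (by
      intro P Q hP hPQ hQX hk hb
      rw [Prod.mk.injEq] at hk
      have hflip := hbnone _ hb
      have hQ := (h.critical hX hQX (hP.mono hPQ) hflip).2.2.1
      have hP' := (h.critical hX (hPQ.trans hQX) hP (by rwa [hk.1, hk.2])).2.2.1
      rw [← hP', ← hQ, hk.2])
    (by
      intro Q hQ hQX x hb
      have hx := hbsome _ _ hb
      have hsub : Q.erase x ⊆ X := (Finset.erase_subset _ _).trans hQX
      obtain ⟨h1, h2, h3⟩ := h.flip hX hQX hQ hx hsub (fun y hy => by simp [hy])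
      obtain ⟨_, h5, h6⟩ := h.flip hX hQX hQ hx (Finset.insert_subset hx.1 hsub)
        (fun y hy => by simp [hy])
      exact ⟨hx.1, h1, by rw [h2, h3], by rw [h5, h6]⟩)
  have hconst' : ∀ A ∈ V, ∀ P ∈ A, ∀ Q ∈ A, C P = C Q ∧ D P = D Q := by
    intro A hA P hP Q hQ
    simpa using hconst A hA P hP Q hQ
  have hcrit' : ∀ Q, {Q} ∈ V →
      Q.Nonempty ∧ Q ⊆ X ∧ ∀ x, ¬ IsFlippable X w M (C Q) (D Q) x := by
    intro Q hQ
    obtain ⟨h1, h2, h3⟩ := hcrit Q hQ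
    exact ⟨h1, h2, fun x => hbnone (C Q, D Q) h3 x⟩
  exact ⟨V, hV, hconst', hcrit'⟩

end IsSphereSystem

end Geometry

end CollapsingHierarchy

/-! ### The collapsing hierarchy. -/

theorem mainTheorem1 (n : ℕ) (X : Finset (EuclideanSpace ℝ (Fin n)))
    (w : EuclideanSpace ℝ (Fin n) → ℝ) (hX : InGeneralPosition X w) :
    ∃ V : Set (Set (Finset (EuclideanSpace ℝ (Fin n)))),
      IsDiscreteGradient (fullSimplex X) V ∧
      ∀ s : ℝ, ∃ wrap : PreAbstractSimplicialComplex (EuclideanSpace ℝ (Fin n)),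
        wrap.faces = wrapSimplices X w s ∧
        (Collapses (cech X w s) (delaunayCech X w s) ∧
          Collapses (delaunayCech X w s) (delaunay X w s) ∧
          Collapses (delaunay X w s) wrap) ∧
        (InducesCollapse V (cech X w s) (delaunayCech X w s) ∧
          InducesCollapse V (delaunayCech X w s) (delaunay X w s) ∧
          InducesCollapse V (delaunay X w s) wrap) ∧
        (SimpleHomotopyEquivalent (cech X w s) (delaunayCech X w s) ∧
          SimpleHomotopyEquivalent (cech X w s) (delaunay X w s) ∧
          SimpleHomotopyEquivalent (cech X w s) wrap) := by
  obtain ⟨M, C, D, h⟩ := exists_isSphereSystem hX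
  obtain ⟨V, hV, hconst, hcrit⟩ := h.exists_gradient hX
  refine ⟨V, hV, fun s => ?_⟩
  let wrap : PreAbstractSimplicialComplex (EuclideanSpace ℝ (Fin n)) :=
    ⟨wrapSimplices X w s, h.wrapSimplices_isRelLowerSet hX⟩
  have hcech : cech X w s ≤ fullSimplex X := fun Q hQ => ⟨hQ.1, hQ.2.1⟩
  have hdelCech : delaunayCech X w s ≤ cech X w s := fun Q hQ => hQ.2
  have hdel : delaunay X w s ≤ delaunayCech X w s := delaunay_le_delaunayCech
  have hwrap : wrap ≤ delaunay X w s := h.wrapSimplices_subset hX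
  -- A complex described by a condition on the two spheres is a union of parts of `V`, as both
  -- spheres are constant on parts.
  have hsat : ∀ (p : WeightedSphere n → WeightedSphere n → Prop)
      (K : PreAbstractSimplicialComplex (EuclideanSpace ℝ (Fin n))),
      (∀ Q ⊆ X, Q.Nonempty → (Q ∈ K.faces ↔ p (C Q) (D Q))) →
      ∀ A ∈ V, ∀ P ∈ A, P ∈ K.faces → A ⊆ K.faces := by
    intro p K hK A hA P hP hPK Q hQ
    have hfull : ∀ R ∈ A, R ∈ (fullSimplex X).faces := fun R hR => by
      rw [← hV.1.2.2]
      exact ⟨A, hA, hR⟩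
    rw [hK Q (hfull Q hQ).2 (hfull Q hQ).1, (hconst A hA Q hQ P hP).1, (hconst A hA Q hQ P hP).2]
    exact (hK P (hfull P hP).2 (hfull P hP).1).1 hPK
  have hs1 := hsat (fun c _ => c.sqRadius ≤ s) (cech X w s) fun Q hQX hQ => h.mem_cech hQX hQ
  have hs2 := hsat (fun c d => (∀ x ∈ X, 0 ≤ d.power w x) ∧ c.sqRadius ≤ s) (delaunayCech X w s)
    fun Q hQX hQ => and_congr (h.mem_delaunayTriangulation hQX hQ) (h.mem_cech hQX hQ)
  have hs3 := hsat (fun _ d => (∀ x ∈ X, 0 ≤ d.power w x) ∧ d.sqRadius ≤ s) (delaunay X w s)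
    fun Q hQX hQ => h.mem_delaunay hQX hQ
  have hs4 := hsat (fun _ d => (∀ x ∈ X, 0 ≤ d.power w x) ∧
    Set.Icc (frontFace X w d) (onFace X w d) ∈ lowerSet X w (singularIntervals X w s)) wrap
    fun Q hQX hQ => h.mem_wrapSimplices hX hQX hQ
  obtain ⟨c1, i1⟩ := hV.collapses (fullSimplex_finite X) hcech hdelCech hs1 hs2 (by
    intro Q hQK hQ
    obtain ⟨hQne, hQX, hflip⟩ := hcrit Q hQ
    obtain ⟨_, hex, _⟩ := h.critical hX hQX hQne hflip
    exact ⟨(h.mem_delaunayTriangulation hQX hQne).2 hex, hQK⟩)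
  obtain ⟨c2, i2⟩ := hV.collapses (fullSimplex_finite X) (hdelCech.trans hcech) hdel hs2 hs3 (by
    intro Q hQK hQ
    obtain ⟨hQne, hQX, hflip⟩ := hcrit Q hQ
    obtain ⟨hCD, hex, _⟩ := h.critical hX hQX hQne hflip
    exact (h.mem_delaunay hQX hQne).2 ⟨hex, hCD ▸ (h.mem_cech hQX hQne).1 hQK.2⟩)
  obtain ⟨c3, i3⟩ := hV.collapses (fullSimplex_finite X) (hdel.trans (hdelCech.trans hcech)) hwrap
    hs3 hs4 (by
    intro Q hQK hQ
    obtain ⟨hQne, hQX, hflip⟩ := hcrit Q hQ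
    obtain ⟨_, hex, hon, hfront⟩ := h.critical hX hQX hQne hflip
    have hI := h.interval_mem hQX hQne hex
    refine (h.mem_wrapSimplices hX hQX hQne).2 ⟨hex, hI, _, ⟨hI, Q, D Q, ?_,
      (h.isDelaunaySphere_iff_eq hQX hQne hex).2 rfl, ((h.mem_delaunay hQX hQne).1 hQK).2⟩,
      Relation.ReflTransGen.refl⟩
    rw [hon, hfront, Set.Icc_self])
  have e2 := c1.trans c2
  exact ⟨wrap, rfl, ⟨c1, c2, c3⟩, ⟨i1, i2, i3⟩, c1.simpleHomotopyEquivalent,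
    Collapses.simpleHomotopyEquivalent e2, Collapses.simpleHomotopyEquivalent (e2.trans c3)⟩
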